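/- Let $k$ be a field of characteristic zero. A \emph{formal cdga} is a non-unital commutative differential graded algebra $A$ over $k$ (cohomologically $\mathbb Z$-graded) with a topology making it the (graded) inverse limit of its finite-dimensional nilpotent quotients $A/I$ by open dg ideals; morphisms are continuous. $A$ is \emph{connected} if $A^i=0$ for $i\le 0$. An \emph{$L_\infty$ algebra} is a homologically $\mathbb Z$-graded space $V$ with graded symmetric operations $m_n\colon(\Sigma V)^{\otimes n}\to\Sigma V$, $n\ge 1$, of degree $-1$ satisfying the generalized Jacobi identities (where $(\Sigma V)_i=V_{i-1}$ and $m_1=d$ is the differential). Its \emph{connected cover} $V\langle 0\rangle$ is the $L_\infty$ algebra with \[V\langle 0\rangle_i=V_i\ (i>0),\qquad V\langle 0\rangle_0=\ker(d\colon V_0\to V_{-1}),\qquad V\langle 0\rangle_i=0\ (i<0)\] and the restricted operations. Let $\mathrm{MC}(V,A)$ be the set of degree $0$ elements $\xi$ of $A\otimes\Sigma V=\varprojlim_I (A/I)\otimes \Sigma V$ with $d_{A\otimes\Sigma V}(\xi)+\sum_{n\ge2}\frac1{n!}m_n^A(\xi^{\otimes n})=0$, where $m_n^A$ is the $A$-linear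 extension of $m_n$. Two such elements are \emph{homotopic} if they are the values at $z=0$ and $z=1$ of an MC element with coefficients in $A[z,dz]=A\otimes k[z,dz]$, and $\mathcal{MC}(V,A)$ denotes the set of homotopy classes (the quotient of $\mathrm{MC}(V,A)$ by the equivalence relation generated by homotopy). Let $V$ be an $L_\infty$ algebra and $A$ a connected formal cdga. Then the map \[\mathcal{MC}(V\langle 0\rangle,A)\longrightarrow\mathcal{MC}(V,A)\] induced by the inclusion $V\langle0\rangle\to V$ is a bijection. It is natural in $A$, with respect to continuous morphisms $A\to B$ of connected formal cdgas, and natural in $V$, with respect to $L_\infty$ morphisms $f=(f_n)\colon V\to U$ and the induced morphisms $f\langle 0\rangle\colon V\langle 0\rangle\to U\langle 0\rangle$: under these bijections, the relation between classes given by $\xi\mapsto\sum_{n\ge1}\frac1{n!}f^A_n(\xi^{\otimes n})$ corresponds exactly to the relation given by $f\langle0\rangle$. -/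

import Mathlib

open scoped TensorProduct

universe u v w

namespace DG

section Grading

variable {k : Type u} [Field k] {M : Type v} [AddCommGroup M] [Module k M]

/-- The linear projection of a graded space onto the sum of its components of even degree. -/
noncomputable def evenProj (gr : ℤ → Submodule k M) (h : DirectSum.IsInternal gr) : M →ₗ[k] M :=
  (DirectSum.toModule k ℤ M fun i => if Even i then (gr i).subtype else 0) ∘ₗ
    (LinearEquiv.ofBijective (DirectSum.coeLinearMap gr) h).symm.toLinearMap

/-- The linear projection of a graded space onto the sum of its components of odd degree. -/
noncomputable def oddProj (gr : ℤ → Submodule k M) (h : DirectSum.IsInternal gr) : M →ₗ[k] M :=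
  LinearMap.id - evenProj gr h

/-- The parity involution `x ↦ (-1)^|x| x` of a graded space. -/
noncomputable def parity (gr : ℤ → Submodule k M) (h : DirectSum.IsInternal gr) : M →ₗ[k] M :=
  evenProj gr h - oddProj gr h

variable {gr : ℤ → Submodule k M} (h : DirectSum.IsInternal gr)

theorem evenProj_apply {i : ℤ} {x : M} (hx : x ∈ gr i) :
    evenProj gr h x = if Even i then x else 0 := by
  have : (LinearEquiv.ofBijective (DirectSum.coeLinearMap gr) h).symm x
      = DirectSum.lof k ℤ (fun i => gr i) i ⟨x, hx⟩ := by
    rw [LinearEquiv.symm_apply_eq]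
    exact (DirectSum.coeLinearMap_lof gr i ⟨x, hx⟩).symm
  simp only [evenProj, LinearMap.comp_apply, LinearEquiv.coe_coe, this, DirectSum.toModule_lof]
  split_ifs <;> simp

theorem parity_apply {i : ℤ} {x : M} (hx : x ∈ gr i) :
    parity gr h x = (Int.negOnePow i : ℤ) • x := by
  simp only [parity, oddProj, LinearMap.sub_apply, LinearMap.id_apply, evenProj_apply h hx]
  split_ifs with hi
  · simp [Int.negOnePow_even i hi]
  · simp [Int.negOnePow_odd i (Int.not_even_iff_odd.1 hi)]

@[elab_as_elim]
theorem internal_induction (h : DirectSum.IsInternal gr) {P : M → Prop} (x : M) (h0 : P 0)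
    (ha : ∀ x y, P x → P y → P (x + y)) (hi : ∀ i, ∀ x ∈ gr i, P x) : P x := by
  have hx : x ∈ ⨆ i, gr i := by rw [h.submodule_iSup_eq_top]; trivial
  exact Submodule.iSup_induction gr (motive := P) hx hi h0 ha

theorem sum_eq_zero_of_internal (h : DirectSum.IsInternal gr) (s : Finset ℤ) (x : ℤ → M)
    (hx : ∀ i ∈ s, x i ∈ gr i) (h0 : ∑ i ∈ s, x i = 0) : ∀ i ∈ s, x i = 0 :=
  (iSupIndep_iff_finsetSum_eq_zero_imp_eq_zero _).1 h.submodule_iSupIndep s x hx h0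

theorem internal_of (ht : ∀ x : M, x ∈ ⨆ i, gr i)
    (h0 : ∀ (s : Finset ℤ) (x : ℤ → M), (∀ i ∈ s, x i ∈ gr i) → ∑ i ∈ s, x i = 0 →
      ∀ i ∈ s, x i = 0) : DirectSum.IsInternal gr :=
  DirectSum.isInternal_submodule_of_iSupIndep_of_iSup_eq_top
    ((iSupIndep_iff_finsetSum_eq_zero_imp_eq_zero _).2 h0)
    (eq_top_iff.2 fun x _ => ht x)

/-- A subspace is homogeneous if it is the sum of its intersections with the components. -/
def IsHomogeneous (gr : ℤ → Submodule k M) (N : Submodule k M) : Prop :=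
  N ≤ ⨆ i, N ⊓ gr i

theorem mem_of_sum_mem (h : DirectSum.IsInternal gr) {N : Submodule k M}
    (hN : IsHomogeneous gr N) (s : Finset ℤ) (x : ℤ → M) (hx : ∀ i ∈ s, x i ∈ gr i)
    (hs : ∑ i ∈ s, x i ∈ N) : ∀ i ∈ s, x i ∈ N := by
  classical
  obtain ⟨f, hf, hsum⟩ := (Submodule.mem_iSup_iff_exists_finsupp _ _).1 (hN hs)
  let y : ℤ → M := fun i => (if i ∈ s then x i else 0) - f i
  have hy : ∀ i ∈ s ∪ f.support, y i = 0 := by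
    apply sum_eq_zero_of_internal h
    · intro i _
      refine (gr i).sub_mem ?_ (hf i).2
      split_ifs with hi
      · exact hx i hi
      · exact (gr i).zero_mem
    · rw [Finset.sum_sub_distrib, sub_eq_zero]
      have e1 : ∑ i ∈ s ∪ f.support, (if i ∈ s then x i else 0) = ∑ i ∈ s, x i := by
        rw [← Finset.sum_filter]
        congr 1
        ext i; simp +contextual
      have e2 : ∑ i ∈ s ∪ f.support, f i = f.sum fun _ x => x := by
        rw [Finsupp.sum]
        refine (Finset.sum_subset Finset.subset_union_right ?_).symm
        intro i _ hi
        simpa using hi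
      rw [e1, e2, hsum]
  intro i hi
  have := hy i (Finset.mem_union_left _ hi)
  simp only [y, if_pos hi, sub_eq_zero] at this
  rw [this]
  exact (hf i).1

theorem parity_comm {M' : Type w} [AddCommGroup M'] [Module k M'] {gr' : ℤ → Submodule k M'}
    (h' : DirectSum.IsInternal gr') (f : M →ₗ[k] M') (hf : ∀ i, ∀ x ∈ gr i, f x ∈ gr' i) (x : M) :
    evenProj gr' h' (f x) = f (evenProj gr h x) := by
  refine internal_induction h x (by simp) (fun x y hx hy => by simp [hx, hy]) fun i x hx => ?_
  rw [evenProj_apply h hx, evenProj_apply h' (hf i x hx)]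
  split_ifs <;> simp

end Grading

/-- A (not necessarily unital, not necessarily formal) commutative differential graded algebra over
`k`, with cohomological grading. -/
structure Cdga (k : Type u) [Field k] where
  carrier : Type v
  [addCommGroup : AddCommGroup carrier]
  [module : Module k carrier]
  gr : ℤ → Submodule k carrier
  internal : DirectSum.IsInternal gr
  mul : carrier →ₗ[k] carrier →ₗ[k] carrier
  d : carrier →ₗ[k] carrier
  mul_mem : ∀ {i j : ℤ} {a b : carrier}, a ∈ gr i → b ∈ gr j → mul a b ∈ gr (i + j)
  mul_assoc : ∀ a b c : carrier, mul (mul a b) c = mul a (mul b c)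
  mul_comm : ∀ {i j : ℤ} {a b : carrier}, a ∈ gr i → b ∈ gr j →
    mul a b = (Int.negOnePow (i * j) : ℤ) • mul b a
  d_mem : ∀ {i : ℤ} {a : carrier}, a ∈ gr i → d a ∈ gr (i + 1)
  d_d : ∀ a : carrier, d (d a) = 0
  leibniz : ∀ {i : ℤ} {a : carrier}, a ∈ gr i → ∀ b : carrier,
    d (mul a b) = mul (d a) b + (Int.negOnePow i : ℤ) • mul a (d b)

attribute [instance] Cdga.addCommGroup Cdga.module

namespace Cdga

variable {k : Type u} [Field k]

/-- The parity involution of a cdga. -/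
noncomputable def sgn (B : Cdga.{u, v} k) : B.carrier →ₗ[k] B.carrier := parity B.gr B.internal

theorem sgn_apply (B : Cdga.{u, v} k) {i : ℤ} {a : B.carrier} (ha : a ∈ B.gr i) :
    B.sgn a = (Int.negOnePow i : ℤ) • a := parity_apply B.internal ha

theorem sgn_mul (B : Cdga.{u, v} k) (a b : B.carrier) :
    B.sgn (B.mul a b) = B.mul (B.sgn a) (B.sgn b) := by
  refine internal_induction B.internal a (by simp) (fun x y hx hy => by simp [hx, hy])
    fun i a ha => ?_
  refine internal_induction B.internal b (by simp) (fun x y hx hy => by simp [hx, hy])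
    fun j b hb => ?_
  rw [B.sgn_apply ha, B.sgn_apply hb, B.sgn_apply (B.mul_mem ha hb), Int.negOnePow_add]
  rw [map_zsmul, map_zsmul, LinearMap.smul_apply, smul_smul, Units.val_mul, _root_.mul_comm]

theorem d_sgn (B : Cdga.{u, v} k) (a : B.carrier) : B.d (B.sgn a) = - B.sgn (B.d a) := by
  refine internal_induction B.internal a (by simp)
    (fun x y hx hy => by simp only [map_add, hx, hy]; abel) fun i a ha => ?_
  rw [B.sgn_apply ha, B.sgn_apply (B.d_mem ha), Int.negOnePow_add]
  simp

/-- The span of all products of `n + 1` elements. -/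
def power (B : Cdga.{u, v} k) : ℕ → Submodule k B.carrier
  | 0 => ⊤
  | n + 1 => Submodule.map₂ B.mul ⊤ (B.power n)

/-- A cdga is nilpotent if all products of sufficiently many elements vanish. -/
def IsNilpotent (B : Cdga.{u, v} k) : Prop := ∃ n, B.power n = ⊥

/-- A morphism of cdgas. -/
structure Hom (B C : Cdga.{u, v} k) where
  toLin : B.carrier →ₗ[k] C.carrier
  map_gr : ∀ {i : ℤ} {a : B.carrier}, a ∈ B.gr i → toLin a ∈ C.gr i
  map_mul : ∀ a b, toLin (B.mul a b) = C.mul (toLin a) (toLin b)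
  map_d : ∀ a, toLin (B.d a) = C.d (toLin a)

theorem Hom.map_sgn {B C : Cdga.{u, v} k} (f : B.Hom C) (a : B.carrier) :
    f.toLin (B.sgn a) = C.sgn (f.toLin a) := by
  refine internal_induction B.internal a (by simp) (fun x y hx hy => by simp [hx, hy])
    fun i a ha => ?_
  rw [B.sgn_apply ha, C.sgn_apply (f.map_gr ha), map_zsmul]

/-- A homogeneous two-sided ideal that is stable under the differential. -/
structure DGIdeal (B : Cdga.{u, v} k) where
  toSubmodule : Submodule k B.carrier
  homogeneous : IsHomogeneous B.gr toSubmodule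
  mul_left : ∀ a, ∀ x ∈ toSubmodule, B.mul a x ∈ toSubmodule
  mul_right : ∀ a, ∀ x ∈ toSubmodule, B.mul x a ∈ toSubmodule
  d_mem : ∀ x ∈ toSubmodule, B.d x ∈ toSubmodule

/-- The quotient of a cdga by a dg ideal. -/
noncomputable def quot (B : Cdga.{u, v} k) (I : B.DGIdeal) : Cdga.{u, v} k where
  carrier := B.carrier ⧸ I.toSubmodule
  gr i := (B.gr i).map I.toSubmodule.mkQ
  internal := by
    apply internal_of
    · intro x
      obtain ⟨x, rfl⟩ := Submodule.mkQ_surjective _ x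
      rw [← Submodule.map_iSup, B.internal.submodule_iSup_eq_top]
      exact ⟨x, trivial, rfl⟩
    · intro s x hx h0 i hi
      choose! y hy hyx using hx
      have : ∑ i ∈ s, y i ∈ I.toSubmodule := by
        rw [← Submodule.Quotient.mk_eq_zero, ← Submodule.mkQ_apply, map_sum, ← h0]
        exact Finset.sum_congr rfl hyx
      rw [← hyx i hi, Submodule.mkQ_apply, Submodule.Quotient.mk_eq_zero]
      exact mem_of_sum_mem B.internal I.homogeneous s y hy this i hi
  mul := I.toSubmodule.liftQ
    ((Submodule.mapQLinear I.toSubmodule I.toSubmodule).comp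
      (B.mul.codRestrict _ fun a x hx => I.mul_left a x hx))
    (by
      intro x hx
      ext y
      exact (Submodule.Quotient.mk_eq_zero _).2 (I.mul_right y x hx))
  d := I.toSubmodule.mapQ I.toSubmodule B.d fun x hx => I.d_mem x hx
  mul_mem := by
    rintro i j _ _ ⟨a, ha, rfl⟩ ⟨b, hb, rfl⟩
    exact ⟨B.mul a b, B.mul_mem ha hb, rfl⟩
  mul_assoc a b c := by
    obtain ⟨a, rfl⟩ := Submodule.mkQ_surjective _ a
    obtain ⟨b, rfl⟩ := Submodule.mkQ_surjective _ b
    obtain ⟨c, rfl⟩ := Submodule.mkQ_surjective _ c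
    exact congrArg I.toSubmodule.mkQ (B.mul_assoc a b c)
  mul_comm := by
    rintro i j _ _ ⟨a, ha, rfl⟩ ⟨b, hb, rfl⟩
    refine (congrArg I.toSubmodule.mkQ (B.mul_comm ha hb)).trans ?_
    rw [map_zsmul]
    rfl
  d_mem := by
    rintro i _ ⟨a, ha, rfl⟩
    exact ⟨B.d a, B.d_mem ha, rfl⟩
  d_d a := by
    obtain ⟨a, rfl⟩ := Submodule.mkQ_surjective _ a
    exact congrArg I.toSubmodule.mkQ (B.d_d a)
  leibniz := by
    rintro i _ ⟨a, ha, rfl⟩ b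
    obtain ⟨b, rfl⟩ := Submodule.mkQ_surjective _ b
    refine (congrArg I.toSubmodule.mkQ (B.leibniz ha b)).trans ?_
    rw [map_add, map_zsmul]
    rfl

section Poly

/-- The product of polynomials in a commuting variable of degree zero, with coefficients
multiplied by `μ`. -/
noncomputable def polyMul {M : Type v} [AddCommGroup M] [Module k M] (μ : M →ₗ[k] M →ₗ[k] M) :
    (ℕ →₀ M) →ₗ[k] (ℕ →₀ M) →ₗ[k] (ℕ →₀ M) :=
  Finsupp.lsum k fun i => LinearMap.flip
    (Finsupp.lsum k fun j => (μ.compr₂ (Finsupp.lsingle (i + j))).flip)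

/-- The derivative of a polynomial. -/
noncomputable def polyDeriv (k : Type u) [Field k] (M : Type v) [AddCommGroup M] [Module k M] :
    (ℕ →₀ M) →ₗ[k] (ℕ →₀ M) :=
  Finsupp.lsum k fun i => (i : k) • Finsupp.lsingle (i - 1)

/-- The value of a polynomial at `t`. -/
noncomputable def polyEval {M : Type v} [AddCommGroup M] [Module k M] (t : k) :
    (ℕ →₀ M) →ₗ[k] M :=
  Finsupp.lsum k fun i => (t ^ i) • LinearMap.id

/-- Apply a linear map to all coefficients. -/
noncomputable abbrev polyMap {M : Type v} [AddCommGroup M] [Module k M]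
    {N : Type w} [AddCommGroup N] [Module k N] (f : M →ₗ[k] N) : (ℕ →₀ M) →ₗ[k] (ℕ →₀ N) :=
  Finsupp.mapRange.linearMap f

variable {M : Type v} [AddCommGroup M] [Module k M]

@[simp] theorem polyMul_single (μ : M →ₗ[k] M →ₗ[k] M) (i j : ℕ) (a b : M) :
    polyMul μ (Finsupp.single i a) (Finsupp.single j b) = Finsupp.single (i + j) (μ a b) := by
  simp [polyMul]

@[simp] theorem polyDeriv_single (i : ℕ) (a : M) :
    polyDeriv k M (Finsupp.single i a) = (i : k) • Finsupp.single (i - 1) a := by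
  simp [polyDeriv]

@[simp] theorem polyEval_single (t : k) (i : ℕ) (a : M) :
    polyEval t (Finsupp.single i a) = t ^ i • a := by
  simp [polyEval]

/-- The polynomials all of whose coefficients lie in a given subspace. -/
def polySub (S : Submodule k M) : Submodule k (ℕ →₀ M) where
  carrier := {p | ∀ n, p n ∈ S}
  add_mem' hp hq n := S.add_mem (hp n) (hq n)
  zero_mem' _ := S.zero_mem
  smul_mem' c _ hp n := S.smul_mem c (hp n)

@[elab_as_elim]
theorem poly_induction {S : Submodule k M} {P : (ℕ →₀ M) → Prop} (p : ℕ →₀ M)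
    (hp : p ∈ polySub S) (h0 : P 0)
    (ha : ∀ p q, P p → P q → P (p + q)) (hs : ∀ n, ∀ a ∈ S, P (Finsupp.single n a)) : P p := by
  classical
  rw [← Finsupp.sum_single p, Finsupp.sum]
  exact Finset.sum_induction _ P ha h0 fun n _ => hs n _ (hp n)

theorem single_mem_polySub {S : Submodule k M} {a : M} (ha : a ∈ S) (n : ℕ) :
    Finsupp.single n a ∈ polySub S := by
  intro m
  rw [Finsupp.single_apply]
  split_ifs
  · exact ha
  · exact S.zero_mem

theorem mem_polySub_top (k : Type u) [Field k] {M : Type v} [AddCommGroup M] [Module k M]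
    (p : ℕ →₀ M) : p ∈ polySub (⊤ : Submodule k M) := fun _ => trivial

theorem polyMul_mem {μ : M →ₗ[k] M →ₗ[k] M} {S T U : Submodule k M}
    (h : ∀ a ∈ S, ∀ b ∈ T, μ a b ∈ U) {p q : ℕ →₀ M} (hp : p ∈ polySub S) (hq : q ∈ polySub T) :
    polyMul μ p q ∈ polySub U := by
  refine poly_induction p hp (by simp) (fun p p' h1 h2 => ?_) (fun n a ha => ?_)
  · rw [map_add, LinearMap.add_apply]; exact Submodule.add_mem _ h1 h2
  refine poly_induction q hq (by simp) (fun p p' h1 h2 => ?_) (fun m b hb => ?_)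
  · rw [map_add]; exact Submodule.add_mem _ h1 h2
  rw [polyMul_single]
  exact single_mem_polySub (h a ha b hb) _

theorem polyMap_mem {N : Type w} [AddCommGroup N] [Module k N] {f : M →ₗ[k] N}
    {S : Submodule k M} {T : Submodule k N} (h : ∀ a ∈ S, f a ∈ T) {p : ℕ →₀ M}
    (hp : p ∈ polySub S) : polyMap f p ∈ polySub T := fun n => h _ (hp n)

theorem polyDeriv_mem {S : Submodule k M} {p : ℕ →₀ M} (hp : p ∈ polySub S) :
    polyDeriv k M p ∈ polySub S := by
  refine poly_induction p hp (by simp) (fun p p' h1 h2 => ?_) (fun n a ha => ?_)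
  · rw [map_add]; exact Submodule.add_mem _ h1 h2
  rw [polyDeriv_single]
  exact Submodule.smul_mem _ _ (single_mem_polySub ha _)

theorem polySgn (B : Cdga.{u, v} k) {i : ℤ} {p : ℕ →₀ B.carrier} (hp : p ∈ polySub (B.gr i)) :
    polyMap B.sgn p = (Int.negOnePow i : ℤ) • p := by
  ext n
  simp [B.sgn_apply (hp n)]

theorem polyMul_comm (B : Cdga.{u, v} k) {i j : ℤ} {p q : ℕ →₀ B.carrier}
    (hp : p ∈ polySub (B.gr i)) (hq : q ∈ polySub (B.gr j)) :
    polyMul B.mul p q = (Int.negOnePow (i * j) : ℤ) • polyMul B.mul q p := by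
  refine poly_induction p hp (by simp) (fun p p' h1 h2 => by simp [h1, h2]) (fun n a ha => ?_)
  refine poly_induction q hq (by simp) (fun p p' h1 h2 => by simp [h1, h2]) (fun m b hb => ?_)
  rw [polyMul_single, polyMul_single, B.mul_comm ha hb, add_comm n m, Finsupp.smul_single]

theorem polyMul_assoc (B : Cdga.{u, v} k) (p q r : ℕ →₀ B.carrier) :
    polyMul B.mul (polyMul B.mul p q) r = polyMul B.mul p (polyMul B.mul q r) := by
  refine poly_induction p (mem_polySub_top k p) (by simp) (fun p p' h1 h2 => by simp [h1, h2]) (fun n a _ => ?_)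
  refine poly_induction q (mem_polySub_top k q) (by simp) (fun p p' h1 h2 => by simp [h1, h2]) (fun m b _ => ?_)
  refine poly_induction r (mem_polySub_top k r) (by simp) (fun p p' h1 h2 => by simp only [map_add, h1, h2]) (fun l c _ => ?_)
  simp [B.mul_assoc, add_assoc]

theorem polyMul_map {N : Type w} [AddCommGroup N] [Module k N] {μ : M →ₗ[k] M →ₗ[k] M}
    {ν : N →ₗ[k] N →ₗ[k] N} {f : M →ₗ[k] N} (h : ∀ a b, f (μ a b) = ν (f a) (f b))
    (p q : ℕ →₀ M) :
    polyMap f (polyMul μ p q) = polyMul ν (polyMap f p) (polyMap f q) := by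
  refine poly_induction p (mem_polySub_top k p) (by simp) (fun p p' h1 h2 => by simp only [map_add, LinearMap.add_apply, h1, h2]) (fun n a _ => ?_)
  refine poly_induction q (mem_polySub_top k q) (by simp) (fun p p' h1 h2 => by simp only [map_add, h1, h2]) (fun m b _ => ?_)
  simp [h]

theorem polyDeriv_map {N : Type w} [AddCommGroup N] [Module k N] (f : M →ₗ[k] N)
    (p : ℕ →₀ M) : polyMap f (polyDeriv k M p) = polyDeriv k N (polyMap f p) := by
  refine poly_induction p (mem_polySub_top k p) (by simp) (fun p p' h1 h2 => by simp only [map_add, h1, h2]) (fun n a _ => ?_)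
  rw [polyDeriv_single, map_smul]
  simp

theorem polyDeriv_mul (μ : M →ₗ[k] M →ₗ[k] M) (p q : ℕ →₀ M) :
    polyDeriv k M (polyMul μ p q) = polyMul μ (polyDeriv k M p) q + polyMul μ p (polyDeriv k M q) := by
  refine poly_induction p (mem_polySub_top k p) (by simp) (fun p p' h1 h2 => by simp only [map_add, LinearMap.add_apply, h1, h2]; abel) (fun n a _ => ?_)
  refine poly_induction q (mem_polySub_top k q) (by simp) (fun p p' h1 h2 => by simp only [map_add, h1, h2]; abel) (fun m b _ => ?_)
  simp only [polyMul_single, polyDeriv_single, map_smul, LinearMap.smul_apply]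
  rcases n with _ | n
  · rcases m with _ | m <;> simp
  · rcases m with _ | m
    · simp
    · rw [show n + 1 + (m + 1) - 1 = n + m + 1 by omega, show n + 1 - 1 + (m + 1) = n + m + 1 by omega,
        show n + 1 + (m + 1 - 1) = n + m + 1 by omega, ← add_smul]
      push_cast
      rfl

theorem polyLeibniz (B : Cdga.{u, v} k) {i : ℤ} {p : ℕ →₀ B.carrier}
    (hp : p ∈ polySub (B.gr i)) (q : ℕ →₀ B.carrier) :
    polyMap B.d (polyMul B.mul p q) = polyMul B.mul (polyMap B.d p) q
      + (Int.negOnePow i : ℤ) • polyMul B.mul p (polyMap B.d q) := by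
  refine poly_induction p hp (by simp) (fun p p' h1 h2 => by simp only [map_add, LinearMap.add_apply, h1, h2, smul_add]; abel) (fun n a ha => ?_)
  refine poly_induction q (mem_polySub_top k q) (by simp) (fun p p' h1 h2 => by simp only [map_add, h1, h2, smul_add]; abel) (fun m b _ => ?_)
  simp [B.leibniz ha]

theorem polySgn_mul (B : Cdga.{u, v} k) (p q : ℕ →₀ B.carrier) :
    polyMap B.sgn (polyMul B.mul p q)
      = polyMul B.mul (polyMap B.sgn p) (polyMap B.sgn q) := polyMul_map B.sgn_mul p q

theorem polyD_sgn (B : Cdga.{u, v} k) (p : ℕ →₀ B.carrier) :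
    polyMap B.d (polyMap B.sgn p) = - polyMap B.sgn (polyMap B.d p) := by
  ext n
  simp [B.d_sgn]

theorem polyD_d (B : Cdga.{u, v} k) (p : ℕ →₀ B.carrier) :
    polyMap B.d (polyMap B.d p) = 0 := by
  ext n
  simp [B.d_d]

/-- The cdga `B[z,dz]`, the tensor product of `B` with the polynomial de Rham algebra of the line,
where `|z| = 0`. The pair `(p, q)` stands for `p(z) + q(z) dz`. -/
noncomputable def deRham (B : Cdga.{u, v} k) : Cdga.{u, v} k where
  carrier := (ℕ →₀ B.carrier) × (ℕ →₀ B.carrier)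
  gr i := (polySub (B.gr i)).prod (polySub (B.gr (i - 1)))
  internal := by
    apply internal_of
    · rintro ⟨p, q⟩
      rw [show (p, q) = (p, 0) + (0, q) by simp]
      refine Submodule.add_mem _ ?_ ?_
      · refine poly_induction (P := fun p => ((p, 0) : (ℕ →₀ B.carrier) × (ℕ →₀ B.carrier)) ∈ _) p (mem_polySub_top k p) (Submodule.zero_mem _) (fun p p' h1 h2 => ?_) (fun n a _ => ?_)
        · simpa using Submodule.add_mem _ h1 h2
        refine internal_induction B.internal a ?_ (fun a b h1 h2 => ?_) fun i a ha => ?_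
        · rw [Finsupp.single_zero]; exact Submodule.zero_mem _
        · simpa using Submodule.add_mem _ h1 h2
        · exact Submodule.mem_iSup_of_mem i ⟨single_mem_polySub ha n, Submodule.zero_mem _⟩
      · refine poly_induction (P := fun p => ((0, p) : (ℕ →₀ B.carrier) × (ℕ →₀ B.carrier)) ∈ _) q (mem_polySub_top k q) (Submodule.zero_mem _) (fun p p' h1 h2 => ?_) (fun n a _ => ?_)
        · simpa using Submodule.add_mem _ h1 h2
        refine internal_induction B.internal a ?_ (fun a b h1 h2 => ?_) fun i a ha => ?_
        · rw [Finsupp.single_zero]; exact Submodule.zero_mem _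
        · simpa using Submodule.add_mem _ h1 h2
        · refine Submodule.mem_iSup_of_mem (i + 1) ⟨Submodule.zero_mem _, ?_⟩
          rw [add_sub_cancel_right]
          exact single_mem_polySub ha n
    · intro s x hx h0
      have h1 : ∀ n, ∀ i ∈ s, (x i).1 n = 0 := fun n => by
        refine sum_eq_zero_of_internal B.internal s _ (fun i hi => (hx i hi).1 n) ?_
        have := congrArg (fun y => y.1 n) h0
        simpa [Prod.fst_sum, Finsupp.finsetSum_apply] using this
      have h2 : ∀ n, ∀ i ∈ s, (x i).2 n = 0 := fun n i hi => by
        have := sum_eq_zero_of_internal B.internal (s.image fun i => i - 1)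
          (fun i => (x (i + 1)).2 n) (by
            intro j hj
            obtain ⟨i, hi, rfl⟩ := Finset.mem_image.1 hj
            rw [sub_add_cancel]
            exact (hx i hi).2 n) (by
            rw [Finset.sum_image (by intro a _ b _ h; simpa using h)]
            have := congrArg (fun y => y.2 n) h0
            simpa [Prod.snd_sum, Finsupp.finsetSum_apply] using this) (i - 1)
              (Finset.mem_image_of_mem _ hi)
        simpa using this
      intro i hi
      ext n
      · exact h1 n i hi
      · exact h2 n i hi
  mul := LinearMap.mk₂ k
    (fun x y => (polyMul B.mul x.1 y.1,
      polyMul B.mul x.1 y.2 + polyMul B.mul x.2 (polyMap B.sgn y.1)))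
    (by intro x x' y; ext1 <;> simp only [Prod.fst_add, Prod.snd_add, map_add, LinearMap.add_apply]; abel)
    (by intro c x y; ext1 <;> simp only [Prod.smul_fst, Prod.smul_snd, map_smul, LinearMap.smul_apply, smul_add])
    (by intro x y y'; ext1 <;> simp only [Prod.fst_add, Prod.snd_add, map_add]; abel)
    (by intro c x y; ext1 <;> simp only [Prod.smul_fst, Prod.smul_snd, map_smul, smul_add])
  d :=
    { toFun := fun x => (polyMap B.d x.1,
        polyMap B.sgn (polyDeriv k B.carrier x.1) + polyMap B.d x.2)
      map_add' := by
        intro x y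
        ext1
        · simp only [Prod.fst_add, map_add]
        · simp only [Prod.fst_add, Prod.snd_add, map_add]; abel
      map_smul' := by
        intro c x
        ext1
        · simp only [Prod.smul_fst, map_smul, RingHom.id_apply]
        · simp only [Prod.smul_fst, Prod.smul_snd, map_smul, smul_add, RingHom.id_apply] }
  mul_mem := by
    rintro i j ⟨p, q⟩ ⟨p', q'⟩ ⟨hp, hq⟩ ⟨hp', hq'⟩
    refine ⟨polyMul_mem (fun a ha b hb => B.mul_mem ha hb) hp hp', Submodule.add_mem _ ?_ ?_⟩
    · refine polyMul_mem (fun a ha b hb => ?_) hp hq'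
      rw [show i + j - 1 = i + (j - 1) by ring]
      exact B.mul_mem ha hb
    · simp only at hp'
      rw [polySgn B hp', map_zsmul]
      refine zsmul_mem (polyMul_mem (fun a ha b hb => ?_) hq hp') _
      rw [show i + j - 1 = i - 1 + j by ring]
      exact B.mul_mem ha hb
  mul_assoc := by
    rintro ⟨p, q⟩ ⟨p', q'⟩ ⟨p'', q''⟩
    simp only [LinearMap.mk₂_apply, polyMul_assoc, map_add, LinearMap.add_apply, polySgn_mul,
      add_assoc]
  mul_comm := by
    rintro i j ⟨p, q⟩ ⟨p', q'⟩ ⟨hp, hq⟩ ⟨hp', hq'⟩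
    simp only [LinearMap.mk₂_apply] at *
    rw [polySgn B hp', polySgn B hp, map_zsmul, map_zsmul, polyMul_comm B hp hp',
      polyMul_comm B hp hq', polyMul_comm B hq hp', Prod.smul_mk, smul_add, smul_smul, smul_smul,
      ← Units.val_mul, ← Units.val_mul, ← Int.negOnePow_add, ← Int.negOnePow_add]
    congr 1
    rw [add_comm]
    rw [show (j + (i - 1) * j).negOnePow = (i * j).negOnePow by congr 1; ring,
      show (i * (j - 1)).negOnePow = (i * j + i).negOnePow by
        rw [Int.negOnePow_eq_iff]; exact ⟨-i, by ring⟩]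
  d_mem := by
    rintro i ⟨p, q⟩ ⟨hp, hq⟩
    refine ⟨polyMap_mem (fun a ha => B.d_mem ha) hp, Submodule.add_mem _ ?_ ?_⟩
    · refine polyMap_mem (S := B.gr i) (fun a ha => ?_) (polyDeriv_mem hp)
      rw [B.sgn_apply ha, add_sub_cancel_right]
      exact zsmul_mem ha _
    · refine polyMap_mem (S := B.gr (i - 1)) (fun a ha => ?_) hq
      rw [show i + 1 - 1 = i - 1 + 1 by ring]
      exact B.d_mem ha
  d_d := by
    rintro ⟨p, q⟩
    simp only [LinearMap.coe_mk, AddHom.coe_mk, map_add, polyD_d, polyD_sgn, polyDeriv_map, add_zero]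
    rw [map_neg, add_neg_cancel]
    rfl
  leibniz := by
    rintro i ⟨p, q⟩ ⟨hp, hq⟩ ⟨p', q'⟩
    simp only [LinearMap.mk₂_apply, LinearMap.coe_mk, AddHom.coe_mk, map_add,
      LinearMap.add_apply] at *
    rw [polyLeibniz B hp, polyLeibniz B hp, polyLeibniz B hq, polyD_sgn, polyDeriv_mul, map_add,
      polySgn_mul, polySgn_mul, polySgn B hp]
    rw [Prod.smul_mk, Prod.mk_add_mk]
    congr 1
    rw [Int.negOnePow_sub]
    simp only [Int.negOnePow_one, mul_neg, mul_one, Units.val_neg, map_neg, neg_smul, smul_neg,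
      neg_neg, map_zsmul, LinearMap.smul_apply, smul_add]
    abel

end Poly

end Cdga

namespace Cdga

variable {k : Type u} [Field k]

/-- The identity morphism. -/
def Hom.id (B : Cdga.{u, v} k) : B.Hom B where
  toLin := LinearMap.id
  map_gr h := h
  map_mul _ _ := rfl
  map_d _ := rfl

/-- The morphism induced on quotients. -/
noncomputable def Hom.quotMap {B C : Cdga.{u, v} k} (f : B.Hom C) (I : B.DGIdeal) (J : C.DGIdeal)
    (h : ∀ x ∈ I.toSubmodule, f.toLin x ∈ J.toSubmodule) : (B.quot I).Hom (C.quot J) where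
  toLin := I.toSubmodule.mapQ J.toSubmodule f.toLin h
  map_gr := by
    rintro i _ ⟨a, ha, rfl⟩
    exact ⟨f.toLin a, f.map_gr ha, rfl⟩
  map_mul a b := by
    obtain ⟨a, rfl⟩ := Submodule.mkQ_surjective _ a
    obtain ⟨b, rfl⟩ := Submodule.mkQ_surjective _ b
    exact congrArg J.toSubmodule.mkQ (f.map_mul a b)
  map_d a := by
    obtain ⟨a, rfl⟩ := Submodule.mkQ_surjective _ a
    exact congrArg J.toSubmodule.mkQ (f.map_d a)

/-- The morphism `B[z,dz] → C[z,dz]` induced by a morphism `B → C`. -/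
noncomputable def Hom.deRham {B C : Cdga.{u, v} k} (f : B.Hom C) : B.deRham.Hom C.deRham where
  toLin := LinearMap.prodMap (polyMap f.toLin) (polyMap f.toLin)
  map_gr := by
    rintro i ⟨p, q⟩ ⟨hp, hq⟩
    exact ⟨polyMap_mem (fun _ => f.map_gr) hp, polyMap_mem (fun _ => f.map_gr) hq⟩
  map_mul := by
    rintro ⟨p, q⟩ ⟨p', q'⟩
    have hs : ∀ r : ℕ →₀ B.carrier,
        polyMap f.toLin (polyMap B.sgn r) = polyMap C.sgn (polyMap f.toLin r) := fun r => by
      ext n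
      simp [f.map_sgn]
    refine Prod.ext (polyMul_map f.map_mul p p') ?_
    change polyMap f.toLin (polyMul B.mul p q' + polyMul B.mul q (polyMap B.sgn p')) =
      polyMul C.mul (polyMap f.toLin p) (polyMap f.toLin q')
        + polyMul C.mul (polyMap f.toLin q) (polyMap C.sgn (polyMap f.toLin p'))
    rw [map_add, polyMul_map f.map_mul, polyMul_map f.map_mul, hs]
  map_d := by
    rintro ⟨p, q⟩
    have hs : ∀ r : ℕ →₀ B.carrier,
        polyMap f.toLin (polyMap B.sgn r) = polyMap C.sgn (polyMap f.toLin r) := fun r => by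
      ext n
      simp [f.map_sgn]
    have hd : ∀ r : ℕ →₀ B.carrier,
        polyMap f.toLin (polyMap B.d r) = polyMap C.d (polyMap f.toLin r) := fun r => by
      ext n
      simp [f.map_d]
    refine Prod.ext (hd p) ?_
    change polyMap f.toLin (polyMap B.sgn (polyDeriv k B.carrier p) + polyMap B.d q) =
      polyMap C.sgn (polyDeriv k C.carrier (polyMap f.toLin p)) + polyMap C.d (polyMap f.toLin q)
    rw [map_add, hs, hd, polyDeriv_map]

/-- The specialization `B[z,dz] → B` at `z = t`, `dz = 0`. -/
noncomputable def spec (B : Cdga.{u, v} k) (t : k) : B.deRham.carrier →ₗ[k] B.carrier :=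
  polyEval t ∘ₗ LinearMap.fst k (ℕ →₀ B.carrier) (ℕ →₀ B.carrier)

theorem spec_deRham {B C : Cdga.{u, v} k} (f : B.Hom C) (t : k) :
    C.spec t ∘ₗ f.deRham.toLin = f.toLin ∘ₗ B.spec t := by
  ext x : 1
  obtain ⟨p, q⟩ := x
  change polyEval t (polyMap f.toLin p) = f.toLin (polyEval t p)
  refine poly_induction p (mem_polySub_top k p) (by simp)
    (fun p p' h1 h2 => by simp only [map_add, h1, h2]) fun n a _ => ?_
  rw [Finsupp.mapRange.linearMap_apply, Finsupp.mapRange_single, polyEval_single, polyEval_single,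
    map_smul]

end Cdga

/-- A formal cdga: a (non-unital) cdga with a linear topology which is the inverse limit (in the
graded sense) of its finite-dimensional nilpotent quotients by open dg ideals. -/
structure FormalCdga (k : Type u) [Field k] extends Cdga.{u, v} k where
  [topology : TopologicalSpace carrier]
  [topologicalAddGroup : IsTopologicalAddGroup carrier]
  [t2 : T2Space carrier]
  /-- the open dg ideals with finite-dimensional nilpotent quotient form a basis at `0` -/
  exists_ideal : ∀ U ∈ nhds (0 : carrier), ∃ I : toCdga.DGIdeal,
    IsOpen (I.toSubmodule : Set carrier) ∧ FiniteDimensional k (carrier ⧸ I.toSubmodule) ∧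
      (toCdga.quot I).IsNilpotent ∧ (I.toSubmodule : Set carrier) ⊆ U
  /-- each homogeneous component is complete -/
  complete : ∀ (i : ℤ)
    (x : {I : toCdga.DGIdeal // IsOpen (I.toSubmodule : Set carrier)} → carrier),
    (∀ I, x I ∈ gr i) →
    (∀ I J, I.1.toSubmodule ≤ J.1.toSubmodule → x I - x J ∈ J.1.toSubmodule) →
    ∃ y ∈ gr i, ∀ I, y - x I ∈ I.1.toSubmodule

attribute [instance] FormalCdga.topology FormalCdga.topologicalAddGroup FormalCdga.t2

namespace FormalCdga

variable {k : Type u} [Field k]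

/-- A formal cdga is connected if it is concentrated in positive degrees. -/
def IsConnected (A : FormalCdga.{u, v} k) : Prop := ∀ i ≤ 0, A.gr i = ⊥

/-- The open dg ideals of a formal cdga. -/
def OpenIdeal (A : FormalCdga.{u, v} k) : Type v :=
  {I : A.DGIdeal // IsOpen (I.toSubmodule : Set A.carrier)}

/-- The quotient of a formal cdga by an open dg ideal. -/
noncomputable def modIdeal (A : FormalCdga.{u, v} k) (I : A.OpenIdeal) : Cdga.{u, v} k := A.quot I.1

/-- The projection `A/I → A/J` for `I ⊆ J`. -/
noncomputable def trans (A : FormalCdga.{u, v} k) (I J : A.OpenIdeal)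
    (h : I.1.toSubmodule ≤ J.1.toSubmodule) : (A.modIdeal I).Hom (A.modIdeal J) :=
  (Cdga.Hom.id A.toCdga).quotMap I.1 J.1 h

/-- A morphism of formal cdgas is a continuous morphism of cdgas. -/
structure Hom (A B : FormalCdga.{u, v} k) extends Cdga.Hom A.toCdga B.toCdga where
  continuous : Continuous toLin

/-- The identity morphism. -/
def Hom.id (A : FormalCdga.{u, v} k) : A.Hom A where
  toHom := Cdga.Hom.id A.toCdga
  continuous := continuous_id

/-- The preimage of an open dg ideal under a morphism. -/
def Hom.comap {A B : FormalCdga.{u, v} k} (f : A.Hom B) (J : B.OpenIdeal) : A.OpenIdeal where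
  val :=
    { toSubmodule := J.1.toSubmodule.comap f.toLin
      homogeneous := by
        intro x hx
        obtain ⟨g, hg, hsum⟩ := (Submodule.mem_iSup_iff_exists_finsupp A.gr x).1 (by
          rw [A.internal.submodule_iSup_eq_top]; trivial)
        rw [← hsum]
        refine Submodule.sum_mem _ fun i hi => Submodule.mem_iSup_of_mem i ⟨?_, hg i⟩
        refine mem_of_sum_mem B.internal J.1.homogeneous g.support (fun i => f.toLin (g i))
          (fun i _ => f.map_gr (hg i)) ?_ i hi
        rw [← map_sum]
        change f.toLin (g.sum fun _ x => x) ∈ _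
        rw [hsum]
        exact hx
      mul_left := fun a x hx => by
        rw [Submodule.mem_comap, f.map_mul]
        exact J.1.mul_left _ _ hx
      mul_right := fun a x hx => by
        rw [Submodule.mem_comap, f.map_mul]
        exact J.1.mul_right _ _ hx
      d_mem := fun x hx => by
        rw [Submodule.mem_comap, f.map_d]
        exact J.1.d_mem _ hx }
  property := J.2.preimage f.continuous

/-- The morphism `A/f⁻¹(J) → B/J` induced by `f : A → B`. -/
noncomputable def Hom.quotAt {A B : FormalCdga.{u, v} k} (f : A.Hom B) (J : B.OpenIdeal) :
    (A.modIdeal (f.comap J)).Hom (B.modIdeal J) :=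
  f.toHom.quotMap (f.comap J).1 J.1 fun _ h => h

end FormalCdga


/-- The Koszul sign of the permutation `(w_0, …, w_{n-1}) ↦ (w_{σ 0}, …, w_{σ (n-1)})` of elements
of degrees `deg 0, …, deg (n-1)`. -/
def koszulSign {n : ℕ} (σ : Equiv.Perm (Fin n)) (deg : Fin n → ℤ) : ℤ :=
  ∏ i, ∏ j, if i < j ∧ σ j < σ i then (Int.negOnePow (deg (σ i) * deg (σ j)) : ℤ) else 1

/-- The signed sum of `F (w_{σ 0}, …, w_{σ (n-1)})` over all permutations `σ`. -/
def koszulSum {V : Type v} {X : Type w} [AddCommGroup X] {n : ℕ} (deg : Fin n → ℤ) (F : (Fin n → V) → X)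
    (w : Fin n → V) : X :=
  ∑ σ : Equiv.Perm (Fin n), koszulSign σ deg • F (w ∘ σ)

section Operations

variable {k : Type u} [Field k] {V : Type v} [AddCommGroup V] [Module k V]

/-- The sum over `1 ≤ i ≤ n` (here `i` is written as `i + 1`) of
`g_{n-i+1}(m_i(w_1, …, w_i), w_{i+1}, …, w_n) / (i! (n-i)!)`. -/
noncomputable def nested {X : Type w} [AddCommGroup X] [Module k X]
    (g : (n : ℕ) → MultilinearMap k (fun _ : Fin n => V) X)
    (m : (n : ℕ) → MultilinearMap k (fun _ : Fin n => V) V) {n : ℕ} (w : Fin n → V) : X :=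
  ∑ i : Fin n, ((((i : ℕ) + 1).factorial * (n - (i + 1)).factorial : ℕ) : k)⁻¹ •
    g (n - (i + 1) + 1) (Fin.cons (m (i + 1) fun j => w (Fin.castLE i.isLt j))
      fun j => w ⟨i + 1 + j, by omega⟩)

/-- The sum over all compositions `n = i_1 + ⋯ + i_r` into positive parts of
`m_r(f_{i_1}(w_1, …), …, f_{i_r}(…, w_n)) / (r! i_1! ⋯ i_r!)`. -/
noncomputable def composite {U : Type w} [AddCommGroup U] [Module k U]
    (m : (n : ℕ) → MultilinearMap k (fun _ : Fin n => U) U)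
    (f : (n : ℕ) → MultilinearMap k (fun _ : Fin n => V) U) {n : ℕ} (w : Fin n → V) : U :=
  ∑ c : Composition n, ((c.length.factorial * ∏ i, (c.blocksFun i).factorial : ℕ) : k)⁻¹ •
    m c.length fun i => f (c.blocksFun i) fun j => w (c.embedding i j)

end Operations

/-- An `L_∞` algebra over a field of characteristic zero: a homologically graded space `V` with
graded symmetric operations `m n` of degree `-1` on the suspension `ΣV`, satisfying the generalized
Jacobi identities. The operation `m 1` is the differential of `ΣV`. The suspension `ΣV` has the same
underlying space as `V`, and an element of `V_{i-1}` has degree `i` in `ΣV`. -/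
structure LInfty (k : Type u) [Field k] where
  carrier : Type v
  [addCommGroup : AddCommGroup carrier]
  [module : Module k carrier]
  gr : ℤ → Submodule k carrier
  internal : DirectSum.IsInternal gr
  m : (n : ℕ) → MultilinearMap k (fun _ : Fin n => carrier) carrier
  m_zero : m 0 = 0
  m_mem : ∀ {n : ℕ} (deg : Fin n → ℤ) (w : Fin n → carrier), (∀ i, w i ∈ gr (deg i - 1)) →
    m n w ∈ gr (∑ i, deg i - 1 - 1)
  m_symm : ∀ {n : ℕ} (deg : Fin n → ℤ) (w : Fin n → carrier), (∀ i, w i ∈ gr (deg i - 1)) →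
    ∀ σ : Equiv.Perm (Fin n), m n (w ∘ σ) = koszulSign σ deg • m n w
  jacobi : ∀ {n : ℕ} (deg : Fin n → ℤ) (w : Fin n → carrier), (∀ i, w i ∈ gr (deg i - 1)) →
    koszulSum deg (nested m m) w = 0

attribute [instance] LInfty.addCommGroup LInfty.module

/-- An `L_∞` morphism `V → U`: graded symmetric maps `f n` of degree `0` from `ΣV` to `ΣU`,
compatible with the operations. -/
structure LInfty.Hom {k : Type u} [Field k] (V U : LInfty.{u, v} k) where
  f : (n : ℕ) → MultilinearMap k (fun _ : Fin n => V.carrier) U.carrier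
  f_zero : f 0 = 0
  f_mem : ∀ {n : ℕ} (deg : Fin n → ℤ) (w : Fin n → V.carrier), (∀ i, w i ∈ V.gr (deg i - 1)) →
    f n w ∈ U.gr (∑ i, deg i - 1)
  f_symm : ∀ {n : ℕ} (deg : Fin n → ℤ) (w : Fin n → V.carrier), (∀ i, w i ∈ V.gr (deg i - 1)) →
    ∀ σ : Equiv.Perm (Fin n), f n (w ∘ σ) = koszulSign σ deg • f n w
  map_m : ∀ {n : ℕ} (deg : Fin n → ℤ) (w : Fin n → V.carrier), (∀ i, w i ∈ V.gr (deg i - 1)) →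
    koszulSum deg (composite U.m f) w = koszulSum deg (nested f V.m) w

/-- A strict `L_∞` morphism: a linear map of degree `0` commuting with all operations. -/
structure LInfty.StrictHom {k : Type u} [Field k] (V U : LInfty.{u, v} k) where
  toLin : V.carrier →ₗ[k] U.carrier
  map_gr : ∀ i, ∀ x ∈ V.gr i, toLin x ∈ U.gr i
  map_m : ∀ (n : ℕ) (w : Fin n → V.carrier), toLin (V.m n w) = U.m n fun i => toLin (w i)

/-- The identity morphism. -/
def LInfty.StrictHom.id {k : Type u} [Field k] (V : LInfty.{u, v} k) : V.StrictHom V where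
  toLin := LinearMap.id
  map_gr _ _ h := h
  map_m _ _ := rfl

theorem map_koszulSum {V : Type v} {V' : Type v} {X : Type w} [AddCommGroup X] {Y : Type w} [AddCommGroup Y]
    (φ : X →+ Y) (ι : V → V') {n : ℕ} (deg : Fin n → ℤ) {F : (Fin n → V) → X}
    {G : (Fin n → V') → Y} (h : ∀ w, φ (F w) = G fun i => ι (w i)) (w : Fin n → V) :
    φ (koszulSum deg F w) = koszulSum deg G fun i => ι (w i) := by
  simp only [koszulSum, map_sum, map_zsmul, h]
  rfl

section Lemmas

variable {k : Type u} [Field k] {V : Type v} [AddCommGroup V] [Module k V]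
  {V' : Type v} [AddCommGroup V'] [Module k V']

theorem map_nested {X : Type w} [AddCommGroup X] [Module k X] {Y : Type w} [AddCommGroup Y]
    [Module k Y] (φ : X →ₗ[k] Y) (ι : V →ₗ[k] V')
    {g : (n : ℕ) → MultilinearMap k (fun _ : Fin n => V) X}
    {m : (n : ℕ) → MultilinearMap k (fun _ : Fin n => V) V}
    {g' : (n : ℕ) → MultilinearMap k (fun _ : Fin n => V') Y}
    {m' : (n : ℕ) → MultilinearMap k (fun _ : Fin n => V') V'}
    (hg : ∀ n w, φ (g n w) = g' n fun i => ι (w i)) (hm : ∀ n w, ι (m n w) = m' n fun i => ι (w i))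
    {n : ℕ} (w : Fin n → V) : φ (nested g m w) = nested g' m' fun i => ι (w i) := by
  simp only [nested, map_sum, map_smul, hg]
  refine Finset.sum_congr rfl fun i _ => ?_
  congr 2
  funext j
  refine Fin.cases ?_ (fun j => ?_) j
  · simp [hm]
  · simp

theorem map_composite {U : Type w} [AddCommGroup U] [Module k U] {U' : Type w} [AddCommGroup U']
    [Module k U'] (φ : U →ₗ[k] U') (ι : V →ₗ[k] V')
    {m : (n : ℕ) → MultilinearMap k (fun _ : Fin n => U) U}
    {f : (n : ℕ) → MultilinearMap k (fun _ : Fin n => V) U}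
    {m' : (n : ℕ) → MultilinearMap k (fun _ : Fin n => U') U'}
    {f' : (n : ℕ) → MultilinearMap k (fun _ : Fin n => V') U'}
    (hm : ∀ n w, φ (m n w) = m' n fun i => φ (w i)) (hf : ∀ n w, φ (f n w) = f' n fun i => ι (w i))
    {n : ℕ} (w : Fin n → V) : φ (composite m f w) = composite m' f' fun i => ι (w i) := by
  simp only [composite, map_sum, map_smul, hm, hf]

theorem multilinear_mem {X : Type w} [AddCommGroup X] [Module k X] {n : ℕ}
    (g : MultilinearMap k (fun _ : Fin n => V) X) (P : ℤ → Submodule k V) (T : Submodule k X)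
    (h : ∀ (deg : Fin n → ℤ) (w : Fin n → V), (∀ i, w i ∈ P (deg i)) → g w ∈ T)
    (w : Fin n → V) (hw : ∀ i, w i ∈ ⨆ j, P j) : g w ∈ T := by
  classical
  choose y hy hsum using fun i => (Submodule.mem_iSup_iff_exists_finsupp P (w i)).1 (hw i)
  have : w = fun i => ∑ j ∈ (y i).support, y i j := funext fun i => (hsum i).symm
  rw [this, MultilinearMap.map_sum_finset]
  exact Submodule.sum_mem _ fun r _ => h r _ fun i => hy i (r i)

end Lemmas

namespace LInfty

variable {k : Type u} [Field k] (V : LInfty.{u, v} k)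

/-- The differential. -/
def d : V.carrier →ₗ[k] V.carrier :=
  (MultilinearMap.ofSubsingleton k V.carrier V.carrier (0 : Fin 1)).symm (V.m 1)

theorem d_apply (x : V.carrier) : V.d x = V.m 1 fun _ => x := rfl

/-- The components of the connected cover: `V_i` for `i > 0`, the cycles of `V_0` for `i = 0`,
and `0` for `i < 0`. -/
def coverGr (i : ℤ) : Submodule k V.carrier :=
  if 0 < i then V.gr i else if i = 0 then V.gr 0 ⊓ LinearMap.ker V.d else ⊥

/-- The underlying subspace of the connected cover. -/
def coverSub : Submodule k V.carrier := ⨆ i, V.coverGr i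

theorem coverGr_le (i : ℤ) : V.coverGr i ≤ V.gr i := by
  unfold coverGr
  split_ifs with h1 h2
  · exact le_rfl
  · subst h2; exact inf_le_left
  · exact bot_le

theorem coverGr_le_sub (i : ℤ) : V.coverGr i ≤ V.coverSub := le_iSup V.coverGr i

end LInfty

namespace LInfty

variable {k : Type u} [Field k]

section Cover

variable (V : LInfty.{u, v} k)

theorem d_eq_zero_of_coverGr {i : ℤ} (hi : i ≤ 0) {x : V.carrier} (hx : x ∈ V.coverGr i) :
    V.d x = 0 := by
  unfold coverGr at hx
  rw [if_neg (by omega)] at hx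
  split_ifs at hx with h
  · exact hx.2
  · rw [(Submodule.mem_bot k).1 hx, map_zero]

theorem eq_zero_of_coverGr {i : ℤ} (hi : i < 0) {x : V.carrier} (hx : x ∈ V.coverGr i) :
    x = 0 := by
  unfold coverGr at hx
  rw [if_neg (by omega), if_neg (by omega)] at hx
  exact (Submodule.mem_bot k).1 hx

theorem mem_coverGr {i : ℤ} (hi : 0 ≤ i) {x : V.carrier} (hx : x ∈ V.gr i)
    (h : i = 0 → V.d x = 0) : x ∈ V.coverGr i := by
  unfold coverGr
  split_ifs with h1 h2
  · exact hx
  · subst h2; exact ⟨hx, h rfl⟩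
  · omega

theorem koszulSign_one {n : ℕ} (deg : Fin n → ℤ) : koszulSign 1 deg = 1 := by
  unfold koszulSign
  refine Finset.prod_eq_one fun i _ => Finset.prod_eq_one fun j _ => if_neg ?_
  simp only [Equiv.Perm.coe_one, id_eq]
  omega

theorem koszulSign_mul_self {n : ℕ} (σ : Equiv.Perm (Fin n)) (deg : Fin n → ℤ) :
    koszulSign σ deg * koszulSign σ deg = 1 := by
  unfold koszulSign
  simp only [← Finset.prod_mul_distrib]
  refine Finset.prod_eq_one fun i _ => Finset.prod_eq_one fun j _ => ?_
  split_ifs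
  · exact Int.isUnit_mul_self (Units.isUnit _)
  · rfl

theorem d_d {i : ℤ} {x : V.carrier} (hx : x ∈ V.gr i) : V.d (V.d x) = 0 := by
  have := V.jacobi (n := 1) (fun _ => i + 1) (fun _ => x) (by simpa using hx)
  simp only [koszulSum, Fintype.sum_unique, nested, Equiv.Perm.default_eq, koszulSign_one,
    one_smul] at this
  have h2 : (((((0 : Fin 1) : ℕ) + 1).factorial * (1 - (((0 : Fin 1) : ℕ) + 1)).factorial : ℕ) : k)⁻¹ = 1 := by
    simp
  erw [h2, one_smul] at this
  rw [d_apply, ← this]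
  refine congrArg (V.m 1) (funext fun j => ?_)
  rw [Subsingleton.elim j 0]
  rfl

theorem d_m_two [CharZero k] {x y : V.carrier} (hx : x ∈ V.gr 0) (hy : y ∈ V.gr 0) (hdx : V.d x = 0)
    (hdy : V.d y = 0) : V.d (V.m 2 ![x, y]) = 0 := by
  have hg : ∀ i, ![x, y] i ∈ V.gr ((fun _ => 1 : Fin 2 → ℤ) i - 1) := by
    intro i
    fin_cases i
    · simpa using hx
    · simpa using hy
  have hd : ∀ i, V.d (![x, y] i) = 0 := by
    intro i
    fin_cases i
    · exact hdx
    · exact hdy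
  have hn : ∀ σ : Equiv.Perm (Fin 2), nested V.m V.m (![x, y] ∘ σ) =
      (2 : k)⁻¹ • V.d (V.m 2 (![x, y] ∘ σ)) := by
    intro σ
    simp only [nested, Fin.sum_univ_two]
    have h1 : V.m (2 - (((0 : Fin 2) : ℕ) + 1) + 1)
        (Fin.cons (V.m (((0 : Fin 2) : ℕ) + 1) fun j => (![x, y] ∘ σ) (Fin.castLE (0 : Fin 2).isLt j))
          fun j => (![x, y] ∘ σ) ⟨((0 : Fin 2) : ℕ) + 1 + j, by omega⟩) = 0 := by
      refine MultilinearMap.map_coord_zero _ 0 ?_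
      rw [Fin.cons_zero]
      exact (congrArg (V.m 1) (funext fun j => by rw [Subsingleton.elim j 0]; rfl)).trans (hd (σ 0))
    rw [h1, smul_zero, zero_add]
    have h2 : (((((1 : Fin 2) : ℕ) + 1).factorial *
        (2 - (((1 : Fin 2) : ℕ) + 1)).factorial : ℕ) : k)⁻¹ = (2 : k)⁻¹ := by
      simp
    refine congrArg₂ _ h2 ?_
    rw [d_apply]
    refine congrArg (V.m 1) (funext fun j => ?_)
    obtain ⟨j, hj⟩ := j
    obtain rfl : j = 0 := by omega
    rfl
  have := V.jacobi (n := 2) (fun _ => 1) ![x, y] hg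
  have hs : ∀ σ : Equiv.Perm (Fin 2),
      koszulSign σ (fun _ => 1) • nested V.m V.m (![x, y] ∘ σ) = (2 : k)⁻¹ • V.d (V.m 2 ![x, y]) := by
    intro σ
    rw [hn, V.m_symm _ _ hg, map_zsmul, smul_comm, smul_smul, koszulSign_mul_self, one_smul]
  simp only [koszulSum, hs, Finset.sum_const, Finset.card_univ, Fintype.card_perm, Fintype.card_fin,
    Nat.factorial_two] at this
  rwa [← Nat.cast_smul_eq_nsmul k, smul_smul, Nat.cast_two, mul_inv_cancel₀ two_ne_zero,
    one_smul] at this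

theorem cover_m_mem [CharZero k] {n : ℕ} (deg : Fin n → ℤ) (w : Fin n → V.carrier)
    (hw : ∀ i, w i ∈ V.coverGr (deg i - 1)) : V.m n w ∈ V.coverGr (∑ i, deg i - 1 - 1) := by
  by_cases hneg : ∃ i, deg i < 1
  · obtain ⟨i, hi⟩ := hneg
    rw [(V.m n).map_coord_zero i (V.eq_zero_of_coverGr (by omega) (hw i))]
    exact Submodule.zero_mem _
  push Not at hneg
  have hsum : (n : ℤ) ≤ ∑ i, deg i := by
    simpa using Finset.sum_le_sum fun i (_ : i ∈ Finset.univ) => hneg i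
  have hgr := V.m_mem deg w fun i => V.coverGr_le _ (hw i)
  match n, deg, w, hw, hneg, hsum, hgr with
  | 0, _, w, _, _, _, _ => rw [V.m_zero]; exact Submodule.zero_mem _
  | 1, deg, w, hw, hneg, hsum, hgr =>
    have hw0 : w = fun _ => w 0 := funext fun i => by rw [Subsingleton.elim i 0]
    have hd : V.m 1 w = V.d (w 0) := by rw [d_apply, ← hw0]
    rw [hd] at hgr ⊢
    rw [Fin.sum_univ_one] at hgr ⊢
    have h0 := hneg 0
    by_cases h1 : deg 0 = 1
    · rw [V.d_eq_zero_of_coverGr (by omega) (hw 0)]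
      exact Submodule.zero_mem _
    · exact V.mem_coverGr (by omega) hgr fun _ => V.d_d (V.coverGr_le _ (hw 0))
  | 2, deg, w, hw, hneg, hsum, hgr =>
    refine V.mem_coverGr (by push_cast at hsum; omega) hgr fun h => ?_
    rw [Fin.sum_univ_two] at h
    have h0 := hneg 0
    have h1 := hneg 1
    have e0 : deg 0 - 1 = 0 := by omega
    have e1 : deg 1 - 1 = 0 := by omega
    have hw2 : w = ![w 0, w 1] := by ext i; fin_cases i <;> rfl
    have g0 := hw 0
    have g1 := hw 1
    rw [e0] at g0
    rw [e1] at g1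
    rw [hw2]
    exact V.d_m_two (V.coverGr_le _ g0) (V.coverGr_le _ g1) (V.d_eq_zero_of_coverGr le_rfl g0)
      (V.d_eq_zero_of_coverGr le_rfl g1)
  | n + 3, deg, w, hw, hneg, hsum, hgr =>
    push_cast at hsum
    exact V.mem_coverGr (by omega) hgr fun h => by omega

theorem m_mem_coverSub [CharZero k] {n : ℕ} (w : Fin n → V.carrier) (hw : ∀ i, w i ∈ V.coverSub) :
    V.m n w ∈ V.coverSub :=
  multilinear_mem (V.m n) V.coverGr V.coverSub (fun deg w hw => V.coverGr_le_sub _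
    (V.cover_m_mem (fun i => deg i + 1) w fun i => by rw [add_sub_cancel_right]; exact hw i)) w hw

/-- The restriction of the operations to the connected cover. -/
def coverM [CharZero k] (n : ℕ) : MultilinearMap k (fun _ : Fin n => V.coverSub) V.coverSub :=
  ((V.m n).compLinearMap fun _ => V.coverSub.subtype).codRestrict V.coverSub
    fun w => V.m_mem_coverSub _ fun i => (w i).2

/-- The connected cover `V⟨0⟩` of an `L_∞` algebra `V`. -/
def cover [CharZero k] : LInfty.{u, v} k where
  carrier := V.coverSub
  gr i := (V.coverGr i).comap V.coverSub.subtype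
  internal := by
    apply internal_of
    · rintro ⟨x, hx⟩
      have := (Submodule.mem_iSup_iff_exists_finsupp V.coverGr x).1 hx
      obtain ⟨g, hg, rfl⟩ := this
      have : (⟨g.sum fun _ x => x, hx⟩ : V.coverSub) =
          ∑ i ∈ g.support, ⟨g i, V.coverGr_le_sub i (hg i)⟩ := by
        ext
        simp [Finsupp.sum]
      rw [this]
      exact Submodule.sum_mem _ fun i _ => Submodule.mem_iSup_of_mem i (hg i)
    · intro s x hx h0 i hi
      ext
      refine sum_eq_zero_of_internal V.internal s (fun i => (x i : V.carrier))
        (fun i hi => V.coverGr_le i (hx i hi)) ?_ i hi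
      simpa using congrArg V.coverSub.subtype h0
  m := V.coverM
  m_zero := by
    ext w
    change V.m 0 _ = 0
    rw [V.m_zero]
    rfl
  m_mem deg w hw := V.cover_m_mem deg (fun i => (w i : V.carrier)) hw
  m_symm deg w hw σ := Subtype.ext <|
    V.m_symm deg (fun i => (w i : V.carrier)) (fun i => V.coverGr_le _ (hw i)) σ
  jacobi deg w hw := by
    refine V.coverSub.subtype_injective ?_
    have h := map_koszulSum V.coverSub.subtype.toAddMonoidHom Subtype.val deg
      (map_nested V.coverSub.subtype V.coverSub.subtype (g := V.coverM) (m := V.coverM) (g' := V.m)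
        (m' := V.m)
        (fun _ _ => rfl) fun _ _ => rfl) w
    exact (h.trans (V.jacobi deg _ fun i => V.coverGr_le _ (hw i))).trans (map_zero _).symm

/-- The natural strict morphism `V⟨0⟩ → V`. -/
def coverIncl [CharZero k] : V.cover.StrictHom V where
  toLin := V.coverSub.subtype
  map_gr i _ h := V.coverGr_le i h
  map_m _ _ := rfl

end Cover

section CoverMap

variable {V U : LInfty.{u, v} k} (f : V.Hom U)

theorem Hom.f_d {i : ℤ} {x : V.carrier} (hx : x ∈ V.gr i) :
    U.d (f.f 1 fun _ => x) = f.f 1 fun _ => V.d x := by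
  have key := f.map_m (n := 1) (fun _ => i + 1) (fun _ => x) (by simpa using hx)
  have hc : ∀ c : Composition 1, c = Composition.single 1 one_pos := by
    have : Fintype.card (Composition 1) = 1 := by rw [composition_card]; rfl
    exact fun c => Fintype.card_le_one_iff.1 this.le _ _
  let _ : Unique (Composition 1) := ⟨⟨Composition.single 1 one_pos⟩, hc⟩
  simp only [koszulSum, Fintype.sum_unique, nested, composite, Equiv.Perm.default_eq,
    koszulSign_one, one_smul] at key
  have h2 : (((((0 : Fin 1) : ℕ) + 1).factorial * (1 - (((0 : Fin 1) : ℕ) + 1)).factorial : ℕ) : k)⁻¹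
      = 1 := by
    simp
  erw [h2, one_smul, one_smul] at key
  refine Eq.trans ?_ (key.trans ?_)
  · rw [d_apply]
    refine congrArg (U.m 1) (funext fun j => ?_)
    rw [Subsingleton.elim j 0]
    rfl
  · refine congrArg (f.f 1) (funext fun j => ?_)
    obtain ⟨j, hj⟩ := j
    have hj' : j < 1 := hj
    obtain rfl : j = 0 := by omega
    rfl

theorem Hom.f_mem_cover {n : ℕ} (deg : Fin n → ℤ) (w : Fin n → V.carrier)
    (hw : ∀ i, w i ∈ V.coverGr (deg i - 1)) : f.f n w ∈ U.coverGr (∑ i, deg i - 1) := by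
  by_cases hneg : ∃ i, deg i < 1
  · obtain ⟨i, hi⟩ := hneg
    rw [(f.f n).map_coord_zero i (V.eq_zero_of_coverGr (by omega) (hw i))]
    exact Submodule.zero_mem _
  push Not at hneg
  have hsum : (n : ℤ) ≤ ∑ i, deg i := by
    simpa using Finset.sum_le_sum fun i (_ : i ∈ Finset.univ) => hneg i
  have hgr := f.f_mem deg w fun i => V.coverGr_le _ (hw i)
  match n, deg, w, hw, hneg, hsum, hgr with
  | 0, _, w, _, _, _, _ => rw [f.f_zero]; exact Submodule.zero_mem _
  | 1, deg, w, hw, hneg, hsum, hgr =>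
    have hw0 : w = fun _ => w 0 := funext fun i => by rw [Subsingleton.elim i 0]
    refine U.mem_coverGr (by simpa using hsum) hgr fun h => ?_
    rw [Fin.sum_univ_one] at h
    rw [hw0, f.f_d (V.coverGr_le _ (hw 0)), V.d_eq_zero_of_coverGr h.le (hw 0)]
    exact (f.f 1).map_coord_zero 0 rfl
  | n + 2, deg, w, hw, hneg, hsum, hgr =>
    push_cast at hsum
    exact U.mem_coverGr (by omega) hgr fun h => by omega

theorem Hom.f_mem_coverSub {n : ℕ} (w : Fin n → V.carrier) (hw : ∀ i, w i ∈ V.coverSub) :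
    f.f n w ∈ U.coverSub :=
  multilinear_mem (f.f n) V.coverGr U.coverSub (fun deg w hw => U.coverGr_le_sub _
    (f.f_mem_cover (fun i => deg i + 1) w fun i => by rw [add_sub_cancel_right]; exact hw i)) w hw

/-- The restriction of the components of an `L_∞` morphism to the connected cover. -/
def Hom.coverF (n : ℕ) : MultilinearMap k (fun _ : Fin n => V.coverSub) U.coverSub :=
  ((f.f n).compLinearMap fun _ => V.coverSub.subtype).codRestrict U.coverSub
    fun w => f.f_mem_coverSub _ fun i => (w i).2

/-- The morphism of connected covers induced by an `L_∞` morphism. -/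
def Hom.cover [CharZero k] : V.cover.Hom U.cover where
  f := f.coverF
  f_zero := by
    ext w
    change f.f 0 _ = 0
    rw [f.f_zero]
    rfl
  f_mem deg w hw := f.f_mem_cover deg (fun i => V.coverSub.subtype (w i)) hw
  f_symm deg w hw σ := Subtype.ext <|
    f.f_symm deg (fun i => V.coverSub.subtype (w i)) (fun i => V.coverGr_le _ (hw i)) σ
  map_m deg w hw := by
    refine U.coverSub.subtype_injective ?_
    have h1 := map_koszulSum U.coverSub.subtype.toAddMonoidHom Subtype.val deg
      (map_composite (m := U.coverM) U.coverSub.subtype V.coverSub.subtype (m' := U.m) (f' := f.f)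
        (f := f.coverF)
        (fun _ _ => rfl) fun _ _ => rfl) w
    have h2 := map_koszulSum U.coverSub.subtype.toAddMonoidHom Subtype.val deg
      (map_nested (m := V.coverM) U.coverSub.subtype V.coverSub.subtype (g' := f.f) (m' := V.m)
        (g := f.coverF)
        (fun _ _ => rfl) fun _ _ => rfl) w
    exact (h1.trans (f.map_m deg _ fun i => V.coverGr_le _ (hw i))).trans h2.symm

end CoverMap

end LInfty

section MaurerCartan

variable {k : Type u} [Field k]

/-- Concatenation `V × V^{⊗n} → V^{⊗(n+1)}`. -/
noncomputable def consTensor (k : Type u) [Field k] (V : Type v) [AddCommGroup V] [Module k V]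
    (n : ℕ) : V →ₗ[k] (⨂[k]^n V) →ₗ[k] (⨂[k]^(n + 1) V) :=
  (PiTensorProduct.lift (R := k) (s := fun _ : Fin n => V)).toLinearMap ∘ₗ
    (PiTensorProduct.tprod k (s := fun _ : Fin (n + 1) => V)).curryLeft

/-- The product `(B ⊗ ΣV) × (B ⊗ (ΣV)^{⊗n}) → B ⊗ (ΣV)^{⊗(n+1)}`,
`(a ⊗ w, b ⊗ t) ↦ (-1)^{|w||b|} ab ⊗ (w ⊗ t)`, where `|w|` is the degree of `w` in `ΣV`, so that `w` is
odd in `ΣV` if and only if it is even in `V`. -/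
noncomputable def consMul (B : Cdga.{u, w} k) (V : LInfty.{u, v} k) (n : ℕ) :
    B.carrier ⊗[k] V.carrier →ₗ[k] B.carrier ⊗[k] (⨂[k]^n V.carrier) →ₗ[k]
      B.carrier ⊗[k] (⨂[k]^(n + 1) V.carrier) :=
  TensorProduct.map₂ B.mul (consTensor k V.carrier n ∘ₗ oddProj V.gr V.internal) +
    TensorProduct.map₂ (B.mul.compl₂ B.sgn) (consTensor k V.carrier n ∘ₗ evenProj V.gr V.internal)

/-- The power `x^{⊗(n+1)} ∈ B ⊗ (ΣV)^{⊗(n+1)}` of an element `x ∈ B ⊗ ΣV`. -/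
noncomputable def tensorPow (B : Cdga.{u, w} k) (V : LInfty.{u, v} k)
    (x : B.carrier ⊗[k] V.carrier) : (n : ℕ) → B.carrier ⊗[k] (⨂[k]^(n + 1) V.carrier)
  | 0 => TensorProduct.map LinearMap.id
      (PiTensorProduct.subsingletonEquiv (R := k) (s := fun _ : Fin 1 => V.carrier) 0).symm.toLinearMap x
  | n + 1 => consMul B V (n + 1) x (tensorPow B V x n)

/-- The component of degree `0` of `B ⊗ ΣV`. -/
def degZero (B : Cdga.{u, w} k) (V : LInfty.{u, v} k) : Submodule k (B.carrier ⊗[k] V.carrier) :=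
  Submodule.span k {x | ∃ i, ∃ a ∈ B.gr i, ∃ y ∈ V.gr (i - 1), x = a ⊗ₜ y}

/-- The `N`-th partial sum of `d_{B ⊗ ΣV}(x) + ∑_{n ≥ 2} m_n^B(x^{⊗n}) / n!`. Here `m_n^B` is the
extension of `m_n` to `B ⊗ ΣV`, which, `m_n` being odd, acts on `B ⊗ (ΣV)^{⊗n}` as
`a ⊗ t ↦ (-1)^|a| a ⊗ m_n(t)`, and `d_{B ⊗ ΣV} = d_B ⊗ 1 + m_1^B`. -/
noncomputable def mcSum (B : Cdga.{u, w} k) (V : LInfty.{u, v} k) (x : B.carrier ⊗[k] V.carrier)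
    (N : ℕ) : B.carrier ⊗[k] V.carrier :=
  TensorProduct.map B.d LinearMap.id x +
    ∑ n ∈ Finset.range N, ((n + 1).factorial : k)⁻¹ •
      TensorProduct.map B.sgn (PiTensorProduct.lift (V.m (n + 1))) (tensorPow B V x n)

/-- `x` is an element of degree `0` of `B ⊗ ΣV` that solves the Maurer-Cartan equation (the partial
sums of the Maurer-Cartan series are eventually zero, which is convergence to zero for discrete
`B`). -/
def IsMC (B : Cdga.{u, w} k) (V : LInfty.{u, v} k) (x : B.carrier ⊗[k] V.carrier) : Prop :=
  x ∈ degZero B V ∧ ∀ᶠ N in Filter.atTop, mcSum B V x N = 0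

/-- The map `B ⊗ ΣV → C ⊗ ΣU` induced by a linear map `B → C` and a strict morphism `V → U`. -/
noncomputable abbrev tmap {B C : Type w} [AddCommGroup B] [Module k B] [AddCommGroup C] [Module k C]
    {V U : LInfty.{u, v} k} (f : B →ₗ[k] C) (g : V.StrictHom U) :
    B ⊗[k] V.carrier →ₗ[k] C ⊗[k] U.carrier := TensorProduct.map f g.toLin

theorem tmap_tensorPow {B C : Cdga.{u, w} k} {V U : LInfty.{u, v} k} (f : B.Hom C)
    (g : V.StrictHom U) (x : B.carrier ⊗[k] V.carrier) (n : ℕ) :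
    TensorProduct.map f.toLin (PiTensorProduct.map fun _ => g.toLin) (tensorPow B V x n) =
      tensorPow C U (tmap f.toLin g x) n := by
  have hcons : ∀ (n : ℕ) (y : V.carrier) (t : ⨂[k]^n V.carrier),
      PiTensorProduct.map (fun _ => g.toLin) (consTensor k V.carrier n y t) =
        consTensor k U.carrier n (g.toLin y) (PiTensorProduct.map (fun _ => g.toLin) t) := by
    intro n y t
    induction t using PiTensorProduct.induction_on with
    | smul_tprod r t =>
      simp only [map_smul]
      congr 1
      simp only [consTensor, LinearMap.comp_apply, LinearEquiv.coe_coe, PiTensorProduct.lift.tprod,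
        MultilinearMap.curryLeft_apply, PiTensorProduct.map_tprod]
      congr 1
      funext i
      refine Fin.cases ?_ (fun i => ?_) i <;> simp
    | add s t hs ht => simp only [map_add, hs, ht]
  have hev : ∀ y, evenProj U.gr U.internal (g.toLin y) = g.toLin (evenProj V.gr V.internal y) :=
    parity_comm V.internal U.internal g.toLin g.map_gr
  have hmul : ∀ (n : ℕ) (x : B.carrier ⊗[k] V.carrier) (t : B.carrier ⊗[k] (⨂[k]^n V.carrier)),
      TensorProduct.map f.toLin (PiTensorProduct.map fun _ => g.toLin) (consMul B V n x t) =
        consMul C U n (tmap f.toLin g x)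
          (TensorProduct.map f.toLin (PiTensorProduct.map fun _ => g.toLin) t) := by
    intro n x t
    induction x using TensorProduct.induction_on with
    | zero => simp
    | add x y hx hy => simp only [map_add, LinearMap.add_apply, hx, hy]
    | tmul a y =>
      induction t using TensorProduct.induction_on with
      | zero => simp
      | add x y hx hy => simp only [map_add, hx, hy]
      | tmul b t =>
        simp [consMul, hcons, hev, oddProj, f.map_mul, f.map_sgn]
  induction n with
  | zero =>
    simp only [tensorPow]
    induction x using TensorProduct.induction_on with
    | zero => simp
    | add x y hx hy => simp only [map_add, hx, hy]
    | tmul a y =>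
      simp only [TensorProduct.map_tmul, LinearMap.id_apply, LinearEquiv.coe_coe]
      congr 1
      simp only [PiTensorProduct.subsingletonEquiv_symm_apply, PiTensorProduct.map_tprod]
      congr 1
      funext i
      obtain rfl : i = (0 : Fin 1) := Subsingleton.elim (α := Fin 1) _ _
      rfl
  | succ n ih => rw [tensorPow, hmul, ih, tensorPow]

theorem tmap_mcSum {B C : Cdga.{u, w} k} {V U : LInfty.{u, v} k} (f : B.Hom C)
    (g : V.StrictHom U) (x : B.carrier ⊗[k] V.carrier) (N : ℕ) :
    tmap f.toLin g (mcSum B V x N) = mcSum C U (tmap f.toLin g x) N := by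
  simp only [mcSum, map_add, map_sum, map_smul, ← tmap_tensorPow]
  congr 1
  · induction x using TensorProduct.induction_on with
    | zero => simp
    | add x y hx hy => simp only [map_add, hx, hy]
    | tmul a y => simp [f.map_d]
  · refine Finset.sum_congr rfl fun n _ => ?_
    congr 1
    generalize tensorPow B V x n = y
    induction y using TensorProduct.induction_on with
    | zero => simp
    | add x y hx hy => simp only [map_add, hx, hy]
    | tmul a t =>
      simp only [TensorProduct.map_tmul, f.map_sgn]
      congr 1
      induction t using PiTensorProduct.induction_on with
      | smul_tprod r t =>
        simp only [map_smul, PiTensorProduct.lift.tprod, PiTensorProduct.map_tprod, g.map_m]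
      | add s t hs ht => simp only [map_add, hs, ht]

theorem IsMC.map {B C : Cdga.{u, w} k} {V U : LInfty.{u, v} k} (f : B.Hom C)
    (g : V.StrictHom U) {x : B.carrier ⊗[k] V.carrier} (hx : IsMC B V x) :
    IsMC C U (tmap f.toLin g x) := by
  refine ⟨?_, hx.2.mono fun N h => by rw [← tmap_mcSum, h, map_zero]⟩
  have h := hx.1
  refine Submodule.span_induction (p := fun x _ => tmap f.toLin g x ∈ degZero C U) ?_ ?_ ?_ ?_ h
  · rintro _ ⟨i, a, ha, y, hy, rfl⟩
    exact Submodule.subset_span ⟨i, _, f.map_gr ha, _, g.map_gr _ _ hy, rfl⟩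
  · simp
  · intro x y _ _ hx hy
    rw [map_add]
    exact Submodule.add_mem _ hx hy
  · intro c x _ hx
    rw [map_smul]
    exact Submodule.smul_mem _ _ hx

/-- A Maurer-Cartan element of an `L_∞` algebra `V` with coefficients in a formal cdga `A`: an
element of the completed tensor product of `A` and `ΣV`, that is, of the limit of the spaces
`A/I ⊗ ΣV` over the open dg ideals `I`, all of whose components are Maurer-Cartan. -/
@[ext] structure MC (V : LInfty.{u, v} k) (A : FormalCdga.{u, w} k) where
  val : ∀ I : A.OpenIdeal, (A.modIdeal I).carrier ⊗[k] V.carrier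
  compat : ∀ (I J : A.OpenIdeal) (h : I.1.toSubmodule ≤ J.1.toSubmodule),
    TensorProduct.map (A.trans I J h).toLin LinearMap.id (val I) = val J
  isMC : ∀ I, IsMC (A.modIdeal I) V (val I)

/-- Two Maurer-Cartan elements are homotopic if they are the values at `z = 0` and `z = 1` of a
Maurer-Cartan element with coefficients in `A[z,dz]`, the limit of the cdgas `(A/I)[z,dz]`. -/
def MC.Homotopic {V : LInfty.{u, v} k} {A : FormalCdga.{u, w} k} (ξ η : MC V A) : Prop :=
  ∃ h : ∀ I : A.OpenIdeal, (A.modIdeal I).deRham.carrier ⊗[k] V.carrier,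
    (∀ (I J : A.OpenIdeal) (hIJ : I.1.toSubmodule ≤ J.1.toSubmodule),
      TensorProduct.map (A.trans I J hIJ).deRham.toLin LinearMap.id (h I) = h J) ∧
    (∀ I, IsMC (A.modIdeal I).deRham V (h I)) ∧
    (∀ I, TensorProduct.map ((A.modIdeal I).spec 0) LinearMap.id (h I) = ξ.val I) ∧
    (∀ I, TensorProduct.map ((A.modIdeal I).spec 1) LinearMap.id (h I) = η.val I)

/-- The Maurer-Cartan moduli set: homotopy classes of Maurer-Cartan elements. -/
def MCmod (V : LInfty.{u, v} k) (A : FormalCdga.{u, w} k) : Type (max v w) :=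
  Quot (MC.Homotopic (V := V) (A := A))

/-- The map `MC(V, A) → MC(U, B)` induced by a morphism `A → B` and a strict morphism `V → U`. -/
noncomputable def MC.map {V U : LInfty.{u, v} k} {A B : FormalCdga.{u, w} k} (f : A.Hom B)
    (g : V.StrictHom U) (ξ : MC V A) : MC U B where
  val J := tmap (f.quotAt J).toLin g (ξ.val (f.comap J))
  compat I J h := by
    have h' : (f.comap I).1.toSubmodule ≤ (f.comap J).1.toSubmodule := fun x hx => h hx
    rw [← ξ.compat _ _ h', ← LinearMap.comp_apply, ← LinearMap.comp_apply, tmap, tmap,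
      ← TensorProduct.map_comp, ← TensorProduct.map_comp]
    congr 2
    refine LinearMap.ext fun x => ?_
    obtain ⟨x, rfl⟩ := Submodule.mkQ_surjective _ x
    rfl
  isMC J := (ξ.isMC _).map _ _

theorem MC.Homotopic.map {V U : LInfty.{u, v} k} {A B : FormalCdga.{u, w} k} (f : A.Hom B)
    (g : V.StrictHom U) {ξ η : MC V A} (h : ξ.Homotopic η) : (ξ.map f g).Homotopic (η.map f g) := by
  obtain ⟨h, hc, hm, h0, h1⟩ := h
  refine ⟨fun J => tmap (f.quotAt J).deRham.toLin g (h (f.comap J)), fun I J hIJ => ?_,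
    fun J => (hm _).map _ _, fun J => ?_, fun J => ?_⟩
  · have h' : (f.comap I).1.toSubmodule ≤ (f.comap J).1.toSubmodule := fun x hx => hIJ hx
    change TensorProduct.map _ _ (tmap _ _ _) = tmap _ _ _
    rw [← hc _ _ h', ← LinearMap.comp_apply, ← LinearMap.comp_apply, tmap, tmap,
      ← TensorProduct.map_comp, ← TensorProduct.map_comp]
    congr 2
    have hq : (B.trans I J hIJ).toLin ∘ₗ (f.quotAt I).toLin =
        (f.quotAt J).toLin ∘ₗ (A.trans _ _ h').toLin := by
      refine LinearMap.ext fun x => ?_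
      obtain ⟨x, rfl⟩ := Submodule.mkQ_surjective _ x
      rfl
    have hp : ∀ p, Cdga.polyMap (B.trans I J hIJ).toLin (Cdga.polyMap (f.quotAt I).toLin p) =
        Cdga.polyMap (f.quotAt J).toLin (Cdga.polyMap (A.trans _ _ h').toLin p) := fun p => by
      ext n
      exact LinearMap.congr_fun hq (p n)
    exact LinearMap.ext fun x => Prod.ext (hp x.1) (hp x.2)
  · change _ = tmap _ _ _
    rw [← h0, ← LinearMap.comp_apply, ← LinearMap.comp_apply, tmap, tmap,
      ← TensorProduct.map_comp, ← TensorProduct.map_comp, Cdga.spec_deRham]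
    rfl
  · change _ = tmap _ _ _
    rw [← h1, ← LinearMap.comp_apply, ← LinearMap.comp_apply, tmap, tmap,
      ← TensorProduct.map_comp, ← TensorProduct.map_comp, Cdga.spec_deRham]
    rfl

/-- The map of Maurer-Cartan moduli sets induced by a morphism `A → B` of formal cdgas and a strict
morphism `V → U`. -/
noncomputable def MCmod.map {V U : LInfty.{u, v} k} {A B : FormalCdga.{u, w} k} (f : A.Hom B)
    (g : V.StrictHom U) : MCmod V A → MCmod U B :=
  Quot.map (MC.map f g) fun _ _ h => h.map f g

/-- `f.MapsTo ξ η` says that the `L_∞` morphism `f : V → U` maps `ξ` to `η`, that is,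
`η = ∑_{n ≥ 1} f_n^A(ξ^{⊗n}) / n!`. -/
def LInfty.Hom.MapsTo {V U : LInfty.{u, v} k} (f : V.Hom U) {A : FormalCdga.{u, w} k}
    (ξ : MC V A) (η : MC U A) : Prop :=
  ∀ I, ∀ᶠ N in Filter.atTop, ∑ n ∈ Finset.range N, ((n + 1).factorial : k)⁻¹ •
    TensorProduct.map LinearMap.id (PiTensorProduct.lift (f.f (n + 1)))
      (tensorPow (A.modIdeal I) V (ξ.val I) n) = η.val I

end MaurerCartan

/-- The relation between classes in Maurer-Cartan moduli sets induced by an `L_∞` morphism, namely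
the graph of the map `MCmod(V, A) → MCmod(U, A)` given on Maurer-Cartan elements by
`ξ ↦ ∑_{n ≥ 1} f_n^A(ξ^{⊗n}) / n!`. -/
def LInfty.Hom.ModMapsTo {k : Type u} [Field k] {V U : LInfty.{u, v} k} (f : V.Hom U)
    {A : FormalCdga.{u, w} k} (x : MCmod V A) (y : MCmod U A) : Prop :=
  ∃ ξ η, Quot.mk _ ξ = x ∧ Quot.mk _ η = y ∧ f.MapsTo ξ η

/-- The map `MCmod(V⟨0⟩, A) → MCmod(V, A)` induced by the natural strict morphism `V⟨0⟩ → V`. -/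
noncomputable def MCmod.fromCover {k : Type u} [Field k] [CharZero k] (V : LInfty.{u, v} k)
    (A : FormalCdga.{u, w} k) : MCmod V.cover A → MCmod V A :=
  MCmod.map (FormalCdga.Hom.id A) V.coverIncl

end DG

/-!
The algebras `A/I` and `(A/I)[z,dz]` are both concentrated in positive degrees: in `B[z,dz]`, the
form `dz` has degree one, so a coefficient of positive degree keeps `q dz` in degree at least two.
Hence Maurer-Cartan elements and homotopies between them are treated by one statement about a
connected cdga `B`, namely `IsMC.exists_cover`: every Maurer-Cartan element of `B ⊗ ΣV` lies in
`B ⊗ ΣV⟨0⟩`.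

An element of degree zero of `B ⊗ ΣV` is a sum of tensors in `Bⁱ ⊗ V_{i-1}` with `i ≥ 1`, and
`V⟨0⟩` agrees with `V` in positive degrees, so only the component in `B¹ ⊗ V_0` can fail to lie in
the connected cover (`sub_projOne_mem`). The part of the Maurer-Cartan equation with coefficients in
`B¹` is linear, because `B¹` contains neither products nor boundaries (`projOne_mcSum`). It says
that the differential of `V` kills the component in `B¹ ⊗ V_0`, which over a field means that this
component lies in `B¹ ⊗ ker d` (`projOne_mem`).

Since `B ⊗ ΣV⟨0⟩ → B ⊗ ΣV` is injective, it follows that `MC(V⟨0⟩, A) → MC(V, A)` is a bijection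
before passing to homotopy classes, and that it preserves and reflects the homotopy relation. It
also preserves and reflects the relation given by an `L_∞` morphism, so no homotopy invariance of
`L_∞` morphisms is needed.
-/

namespace DG

/-! ### Components of a graded space -/

section Component

variable {k : Type u} [Field k] {M : Type v} [AddCommGroup M] [Module k M]

/-- The projection of a graded space onto its component of degree `i`, as an endomorphism. -/
noncomputable def componentProj (gr : ℤ → Submodule k M) (h : DirectSum.IsInternal gr) (i : ℤ) :
    M →ₗ[k] M :=
  (gr i).subtype ∘ₗ DirectSum.component k ℤ (fun i => gr i) i ∘ₗ
    (LinearEquiv.ofBijective (DirectSum.coeLinearMap gr) h).symm.toLinearMap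

variable {gr : ℤ → Submodule k M} (h : DirectSum.IsInternal gr)

theorem componentProj_apply {i j : ℤ} {x : M} (hx : x ∈ gr j) :
    componentProj gr h i x = if j = i then x else 0 := by
  have : (LinearEquiv.ofBijective (DirectSum.coeLinearMap gr) h).symm x
      = DirectSum.lof k ℤ (fun i => gr i) j ⟨x, hx⟩ := by
    rw [LinearEquiv.symm_apply_eq]
    exact (DirectSum.coeLinearMap_lof gr j ⟨x, hx⟩).symm
  simp only [componentProj, LinearMap.comp_apply, LinearEquiv.coe_coe, this]
  split_ifs with hij
  · subst hij
    rw [DirectSum.component.lof_self]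
    rfl
  · rw [DirectSum.component.of, dif_neg hij, map_zero]

theorem componentProj_mem (i : ℤ) (x : M) : componentProj gr h i x ∈ gr i :=
  Submodule.coe_mem _

end Component

/-! ### Connected cdgas and their component of degree one -/

namespace Cdga

variable {k : Type u} [Field k]

/-- A cdga is connected if it is concentrated in positive degrees. The notion is needed for cdgas
without topology, such as `(A/I)[z,dz]`. -/
def IsConnected (B : Cdga.{u, w} k) : Prop := ∀ i ≤ 0, B.gr i = ⊥

theorem IsConnected.quot {B : Cdga.{u, w} k} (hB : B.IsConnected) (I : B.DGIdeal) :
    (B.quot I).IsConnected := fun i hi => by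
  change (B.gr i).map _ = ⊥
  rw [hB i hi, Submodule.map_bot]

theorem IsConnected.deRham {B : Cdga.{u, w} k} (hB : B.IsConnected) : B.deRham.IsConnected := by
  have h : ∀ i ≤ 0, polySub (B.gr i) = ⊥ := fun i hi => by
    rw [hB i hi, eq_bot_iff]
    exact fun p hp => Finsupp.ext fun n => (Submodule.mem_bot k).1 (hp n)
  intro i hi
  change (polySub (B.gr i)).prod (polySub (B.gr (i - 1))) = ⊥
  rw [h i hi, h (i - 1) (by omega), Submodule.prod_bot]

/-- The projection of a cdga onto its component of degree one. -/
noncomputable def projOne (B : Cdga.{u, w} k) : B.carrier →ₗ[k] B.carrier :=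
  componentProj B.gr B.internal 1

theorem projOne_apply (B : Cdga.{u, w} k) {i : ℤ} {a : B.carrier} (ha : a ∈ B.gr i) :
    B.projOne a = if i = 1 then a else 0 := componentProj_apply B.internal ha

theorem projOne_sgn (B : Cdga.{u, w} k) (a : B.carrier) :
    B.projOne (B.sgn a) = -B.projOne a := by
  refine internal_induction B.internal a (by simp)
    (fun x y hx hy => by simp only [map_add, hx, hy]; abel) fun i a ha => ?_
  rw [B.sgn_apply ha, map_zsmul, B.projOne_apply ha]
  split_ifs with hi
  · simp [hi]
  · simp

/-- A connected cdga has nothing in degree zero, hence no boundaries in degree one. -/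
theorem IsConnected.projOne_d {B : Cdga.{u, w} k} (hB : B.IsConnected) (a : B.carrier) :
    B.projOne (B.d a) = 0 := by
  refine internal_induction B.internal a (by simp)
    (fun x y hx hy => by simp only [map_add, hx, hy, add_zero]) fun i a ha => ?_
  rw [B.projOne_apply (B.d_mem ha)]
  split_ifs with hi
  · rw [hB i (by omega), Submodule.mem_bot] at ha
    rw [ha, map_zero]
  · rfl

/-- Products in a connected cdga have degree at least two. -/
theorem IsConnected.projOne_mul {B : Cdga.{u, w} k} (hB : B.IsConnected) (a b : B.carrier) :
    B.projOne (B.mul a b) = 0 := by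
  refine internal_induction B.internal a (by simp)
    (fun x y hx hy => by simp only [map_add, LinearMap.add_apply, hx, hy, add_zero]) fun i a ha => ?_
  refine internal_induction B.internal b (by simp)
    (fun x y hx hy => by simp only [map_add, hx, hy, add_zero]) fun j b hb => ?_
  by_cases hi : i ≤ 0
  · rw [hB i hi, Submodule.mem_bot] at ha
    simp [ha]
  by_cases hj : j ≤ 0
  · rw [hB j hj, Submodule.mem_bot] at hb
    simp [hb]
  rw [B.projOne_apply (B.mul_mem ha hb), if_neg (by omega)]

end Cdga

/-! ### Maurer-Cartan elements over a connected cdga -/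

section Lift

variable {k : Type u} [Field k]

/-- The degree-one part of the Maurer-Cartan series over a connected cdga is linear: only the
differential of `V` contributes. -/
theorem projOne_mcSum {B : Cdga.{u, w} k} (hB : B.IsConnected) (V : LInfty.{u, v} k)
    (x : B.carrier ⊗[k] V.carrier) (N : ℕ) :
    TensorProduct.map B.projOne LinearMap.id (mcSum B V x (N + 1)) =
      -TensorProduct.map B.projOne V.d x := by
  have hhigher : ∀ (n : ℕ) (g : (⨂[k]^(n + 1) V.carrier) →ₗ[k] V.carrier)
      (x : B.carrier ⊗[k] V.carrier) (t : B.carrier ⊗[k] (⨂[k]^n V.carrier)),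
      TensorProduct.map B.projOne LinearMap.id
        (TensorProduct.map B.sgn g (consMul B V n x t)) = 0 := by
    intro n g x t
    induction x using TensorProduct.induction_on with
    | zero => simp
    | add x y hx hy => simp only [map_add, LinearMap.add_apply, hx, hy, add_zero]
    | tmul a y =>
      induction t using TensorProduct.induction_on with
      | zero => simp
      | add s t hs ht => simp only [map_add, hs, ht, add_zero]
      | tmul b t => simp [consMul, B.projOne_sgn, hB.projOne_mul]
  have hd : ∀ x : B.carrier ⊗[k] V.carrier,
      TensorProduct.map B.projOne LinearMap.id (TensorProduct.map B.d LinearMap.id x) = 0 := by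
    intro x
    induction x using TensorProduct.induction_on with
    | zero => simp
    | add x y hx hy => simp only [map_add, hx, hy, add_zero]
    | tmul a y => simp [hB.projOne_d]
  have hone : ∀ x : B.carrier ⊗[k] V.carrier, TensorProduct.map B.projOne LinearMap.id
      (TensorProduct.map B.sgn (PiTensorProduct.lift (V.m 1)) (tensorPow B V x 0)) =
        -TensorProduct.map B.projOne V.d x := by
    intro x
    rw [tensorPow]
    induction x using TensorProduct.induction_on with
    | zero => simp
    | add x y hx hy => simp only [map_add, hx, hy, neg_add]
    | tmul a y => simp [B.projOne_sgn, TensorProduct.neg_tmul, V.d_apply]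
  simp only [mcSum, map_add, map_sum, map_smul]
  rw [hd, Finset.sum_range_succ', Finset.sum_eq_zero fun n _ => by rw [tensorPow, hhigher, smul_zero],
    hone]
  simp

variable [CharZero k]

theorem coverIncl_injective (B : Type w) [AddCommGroup B] [Module k B] (V : LInfty.{u, v} k) :
    Function.Injective (tmap (LinearMap.id : B →ₗ[k] B) V.coverIncl) :=
  Module.Flat.lTensor_preserves_injective_linearMap _ V.coverSub.subtype_injective

/-- Tensors of a homogeneous element of `B` and an element of the connected cover of the matching
degree come from `B ⊗ ΣV⟨0⟩` in degree zero. -/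
theorem tmul_mem_map_degZero (B : Cdga.{u, w} k) (V : LInfty.{u, v} k) {i : ℤ} {a : B.carrier}
    (ha : a ∈ B.gr i) {y : V.carrier} (hy : y ∈ V.coverGr (i - 1)) :
    a ⊗ₜ y ∈ (degZero B V.cover).map (tmap LinearMap.id V.coverIncl) :=
  ⟨a ⊗ₜ ⟨y, V.coverGr_le_sub _ hy⟩, Submodule.subset_span ⟨i, a, ha, _, hy, rfl⟩, rfl⟩

/-- Over a connected cdga, every element of degree zero of `B ⊗ ΣV` lies, up to its component in
`B¹ ⊗ V_0`, in the connected cover. -/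
theorem sub_projOne_mem {B : Cdga.{u, w} k} (hB : B.IsConnected) (V : LInfty.{u, v} k)
    {x : B.carrier ⊗[k] V.carrier} (hx : x ∈ degZero B V) :
    x - TensorProduct.map B.projOne LinearMap.id x ∈
      (degZero B V.cover).map (tmap LinearMap.id V.coverIncl) := by
  refine Submodule.span_induction (p := fun x _ => x - TensorProduct.map B.projOne LinearMap.id x ∈
    (degZero B V.cover).map (tmap LinearMap.id V.coverIncl)) ?_ (by simp) ?_ ?_ hx
  · rintro _ ⟨i, a, ha, y, hy, rfl⟩
    rw [TensorProduct.map_tmul, B.projOne_apply ha, LinearMap.id_apply]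
    split_ifs with hi
    · rw [sub_self]
      exact Submodule.zero_mem _
    rw [TensorProduct.zero_tmul, sub_zero]
    by_cases hi0 : i ≤ 0
    · rw [hB i hi0, Submodule.mem_bot] at ha
      rw [ha, TensorProduct.zero_tmul]
      exact Submodule.zero_mem _
    · exact tmul_mem_map_degZero B V ha (V.mem_coverGr (by omega) hy fun h => by omega)
  · intro x y _ _ hx hy
    rw [map_add, add_sub_add_comm]
    exact Submodule.add_mem _ hx hy
  · intro c x _ hx
    rw [map_smul, ← smul_sub]
    exact Submodule.smul_mem _ _ hx

/-- If the component in `B¹ ⊗ V_0` of an element of degree zero is a cycle for the differential of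
`V`, it lies in the connected cover: tensoring with `B` over a field preserves kernels. -/
theorem projOne_mem (B : Cdga.{u, w} k) (V : LInfty.{u, v} k)
    {x : B.carrier ⊗[k] V.carrier} (hx : x ∈ degZero B V)
    (hd : TensorProduct.map B.projOne V.d x = 0) :
    TensorProduct.map B.projOne LinearMap.id x ∈
      (degZero B V.cover).map (tmap LinearMap.id V.coverIncl) := by
  obtain ⟨z, hz⟩ : TensorProduct.map B.projOne LinearMap.id x ∈
      LinearMap.range ((V.gr 0).subtype.lTensor B.carrier) := by
    refine Submodule.span_induction (p := fun x _ => TensorProduct.map B.projOne LinearMap.id x ∈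
      LinearMap.range ((V.gr 0).subtype.lTensor B.carrier)) ?_ (by simp) ?_ ?_ hx
    · rintro _ ⟨i, a, ha, y, hy, rfl⟩
      rw [TensorProduct.map_tmul, B.projOne_apply ha]
      split_ifs with hi
      · subst hi
        exact ⟨a ⊗ₜ ⟨y, by simpa using hy⟩, rfl⟩
      · rw [TensorProduct.zero_tmul]
        exact Submodule.zero_mem _
    · intro x y _ _ hx hy
      rw [map_add]
      exact Submodule.add_mem _ hx hy
    · intro c x _ hx
      rw [map_smul]
      exact Submodule.smul_mem _ _ hx
  let δ : V.gr 0 →ₗ[k] V.carrier := V.d ∘ₗ (V.gr 0).subtype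
  have hδ : δ.lTensor B.carrier z = 0 := by
    rw [LinearMap.lTensor_comp_apply, hz, ← LinearMap.comp_apply, LinearMap.lTensor,
      ← TensorProduct.map_comp]
    exact hd
  obtain ⟨t, rfl⟩ := (Module.Flat.lTensor_exact B.carrier
    (LinearMap.exact_subtype_ker_map δ) z).1 hδ
  -- the projection is idempotent, so the coefficients of `t` may be taken of degree one
  have hidem : TensorProduct.map B.projOne LinearMap.id
      (TensorProduct.map B.projOne (LinearMap.id : V.carrier →ₗ[k] V.carrier) x) =
        TensorProduct.map B.projOne LinearMap.id x := by
    rw [← LinearMap.comp_apply, ← TensorProduct.map_comp]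
    congr 2
    refine LinearMap.ext fun a => ?_
    exact (B.projOne_apply (componentProj_mem B.internal 1 a)).trans (if_pos rfl)
  rw [← hidem, ← hz]
  clear hz hδ hidem
  induction t using TensorProduct.induction_on with
  | zero => simp
  | add s t hs ht =>
    simp only [map_add]
    exact Submodule.add_mem _ hs ht
  | tmul a y =>
    exact tmul_mem_map_degZero B V (componentProj_mem B.internal 1 a) (V.mem_coverGr (by omega)
      (by simp) fun _ => y.2)

/-- Maurer-Cartan elements over a connected cdga come from the connected cover. -/
theorem IsMC.exists_cover {B : Cdga.{u, w} k} (hB : B.IsConnected) {V : LInfty.{u, v} k}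
    {x : B.carrier ⊗[k] V.carrier} (hx : IsMC B V x) :
    ∃ y, IsMC B V.cover y ∧ tmap LinearMap.id V.coverIncl y = x := by
  have hd : TensorProduct.map B.projOne V.d x = 0 := by
    obtain ⟨N, hN⟩ := Filter.eventually_atTop.1 hx.2
    rw [← neg_eq_zero, ← projOne_mcSum hB V x N, hN _ N.le_succ, map_zero]
  obtain ⟨y, hy, hyx⟩ : x ∈ (degZero B V.cover).map (tmap LinearMap.id V.coverIncl) := by
    rw [← sub_add_cancel x (TensorProduct.map B.projOne LinearMap.id x)]
    exact Submodule.add_mem _ (sub_projOne_mem hB V hx.1) (projOne_mem B V hx.1 hd)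
  refine ⟨y, ⟨hy, hx.2.mono fun N h => coverIncl_injective _ V ?_⟩, hyx⟩
  rw [map_zero, ← h, ← hyx]
  exact tmap_mcSum (Cdga.Hom.id B) V.coverIncl y N

end Lift

/-! ### Moduli sets -/

section Moduli

theorem FormalCdga.IsConnected.modIdeal {k : Type u} [Field k] {A : FormalCdga.{u, w} k}
    (hA : A.IsConnected) (I : A.OpenIdeal) :
    (A.modIdeal I).IsConnected :=
  Cdga.IsConnected.quot (B := A.toCdga) hA I.1

variable {k : Type u} [Field k] [CharZero k] {V : LInfty.{u, v} k} {A : FormalCdga.{u, w} k}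

/-- The map `MC(V⟨0⟩, A) → MC(V, A)` induced by the inclusion. -/
noncomputable abbrev MC.fromCover (ξ : MC V.cover A) : MC V A :=
  ξ.map (FormalCdga.Hom.id A) V.coverIncl

theorem MC.fromCover_val (ξ : MC V.cover A) (I : A.OpenIdeal) :
    ξ.fromCover.val I = tmap LinearMap.id V.coverIncl (ξ.val I) := by
  -- the preimage of `I` under the identity morphism is `I` by definition
  change tmap _ _ _ = _
  congr 2
  refine LinearMap.ext fun x => ?_
  obtain ⟨x, rfl⟩ := Submodule.mkQ_surjective _ x
  rfl

/-- Equations between coefficient changes may be checked in `C ⊗ ΣV` instead of `C ⊗ ΣV⟨0⟩`. This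
is used both for the compatibility of families over the open ideals and for the end points of a
homotopy. -/
theorem map_eq_of_coverIncl {B C : Type w} [AddCommGroup B] [Module k B] [AddCommGroup C]
    [Module k C] (f : B →ₗ[k] C) {x : B ⊗[k] V.cover.carrier} {y : C ⊗[k] V.cover.carrier}
    (h : TensorProduct.map f LinearMap.id (tmap LinearMap.id V.coverIncl x) =
      tmap LinearMap.id V.coverIncl y) : TensorProduct.map f LinearMap.id x = y := by
  refine coverIncl_injective C V (Eq.trans ?_ h)
  rw [← LinearMap.comp_apply, ← LinearMap.comp_apply, tmap, tmap, ← TensorProduct.map_comp,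
    ← TensorProduct.map_comp]
  rfl

theorem MC.fromCover_bijective (hA : A.IsConnected) :
    Function.Bijective (MC.fromCover (V := V) (A := A)) := by
  refine ⟨fun ξ η h => MC.ext (funext fun I => coverIncl_injective _ V ?_), fun ξ => ?_⟩
  · rw [← MC.fromCover_val, ← MC.fromCover_val, h]
  · choose y hy hyx using fun I => (ξ.isMC I).exists_cover (hA.modIdeal I)
    refine ⟨⟨y, fun I J hIJ => map_eq_of_coverIncl _ ?_, hy⟩, MC.ext (funext fun I => ?_)⟩
    · rw [hyx, hyx, ξ.compat I J hIJ]
    · rw [MC.fromCover_val, hyx]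

/-- Homotopies of Maurer-Cartan elements also come from the connected cover, since `(A/I)[z,dz]` is
again connected. -/
theorem MC.fromCover_homotopic (hA : A.IsConnected) (ξ η : MC V.cover A) :
    ξ.Homotopic η ↔ ξ.fromCover.Homotopic η.fromCover := by
  refine ⟨fun h => h.map _ _, ?_⟩
  rintro ⟨h, hc, hm, h0, h1⟩
  choose y hy hyx using fun I => (hm I).exists_cover (hA.modIdeal I).deRham
  refine ⟨y, fun I J hIJ => map_eq_of_coverIncl _ ?_, hy, fun I => map_eq_of_coverIncl _ ?_,
    fun I => map_eq_of_coverIncl _ ?_⟩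
  · rw [hyx, hyx, hc I J hIJ]
  · rw [hyx, h0, MC.fromCover_val]
  · rw [hyx, h1, MC.fromCover_val]

theorem MCmod.fromCover_bijective (hA : A.IsConnected) :
    Function.Bijective (MCmod.fromCover V A) :=
  (Quot.congr (Equiv.ofBijective _ (MC.fromCover_bijective hA))
    (MC.fromCover_homotopic hA)).bijective

theorem LInfty.Hom.cover_mapsTo {U : LInfty.{u, v} k} (f : V.Hom U) (ξ : MC V.cover A)
    (η : MC U.cover A) : f.cover.MapsTo ξ η ↔ f.MapsTo ξ.fromCover η.fromCover := by
  have hf : ∀ n, U.coverIncl.toLin ∘ₗ PiTensorProduct.lift (f.cover.f n) =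
      PiTensorProduct.lift (f.f n) ∘ₗ PiTensorProduct.map fun _ => V.coverIncl.toLin := fun n => by
    refine PiTensorProduct.ext (MultilinearMap.ext fun w => ?_)
    simp only [LinearMap.compMultilinearMap_apply, LinearMap.comp_apply,
      PiTensorProduct.map_tprod, PiTensorProduct.lift.tprod]
    rfl
  refine forall_congr' fun I => Filter.eventually_congr (Filter.Eventually.of_forall fun N => ?_)
  rw [← (coverIncl_injective _ U).eq_iff, MC.fromCover_val, MC.fromCover_val, map_sum]
  refine iff_of_eq (congrArg (· = _) (Finset.sum_congr rfl fun n _ => ?_))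
  rw [map_smul]
  congr 1
  have := tmap_tensorPow (Cdga.Hom.id (A.modIdeal I)) V.coverIncl (ξ.val I) n
  change _ = tensorPow (A.modIdeal I) V (tmap LinearMap.id V.coverIncl (ξ.val I)) n at this
  rw [← this, ← LinearMap.comp_apply, ← LinearMap.comp_apply, tmap, ← TensorProduct.map_comp,
    ← TensorProduct.map_comp]
  exact congrArg (fun g => TensorProduct.map LinearMap.id g _) (hf (n + 1))

theorem LInfty.Hom.cover_modMapsTo (hA : A.IsConnected) {U : LInfty.{u, v} k} (f : V.Hom U)
    (x : MCmod V.cover A) (y : MCmod U.cover A) :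
    f.cover.ModMapsTo x y ↔ f.ModMapsTo (MCmod.fromCover V A x) (MCmod.fromCover U A y) := by
  constructor
  · rintro ⟨ξ, η, rfl, rfl, h⟩
    exact ⟨_, _, rfl, rfl, (f.cover_mapsTo ξ η).1 h⟩
  · rintro ⟨ξ, η, hξ, hη, h⟩
    obtain ⟨ξ, rfl⟩ := (MC.fromCover_bijective hA).2 ξ
    obtain ⟨η, rfl⟩ := (MC.fromCover_bijective hA).2 η
    exact ⟨ξ, η, (MCmod.fromCover_bijective hA).1 hξ, (MCmod.fromCover_bijective hA).1 hη,
      (f.cover_mapsTo ξ η).2 h⟩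

theorem MCmod.fromCover_map {B : FormalCdga.{u, w} k} (f : A.Hom B) (x : MCmod V.cover A) :
    MCmod.fromCover V B (MCmod.map f (LInfty.StrictHom.id V.cover) x) =
      MCmod.map f (LInfty.StrictHom.id V) (MCmod.fromCover V A x) := by
  induction x using Quot.ind with | mk ξ => ?_
  refine congrArg (Quot.mk _) (MC.ext (funext fun J => ?_))
  change MC.val (MC.fromCover (ξ.map f (LInfty.StrictHom.id V.cover))) J =
    tmap _ _ (ξ.fromCover.val (f.comap J))
  rw [MC.fromCover_val, MC.fromCover_val]
  change tmap _ _ (tmap _ _ _) = _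
  rw [← LinearMap.comp_apply, ← LinearMap.comp_apply, tmap, tmap, tmap, tmap,
    ← TensorProduct.map_comp, ← TensorProduct.map_comp]
  rfl

end Moduli

end DG

theorem mainTheorem11 {k : Type u} [Field k] [CharZero k] (V : DG.LInfty.{u, v} k)
    (A : DG.FormalCdga.{u, w} k) (hA : A.IsConnected) :
    Function.Bijective (DG.MCmod.fromCover V A) ∧
    (∀ (B : DG.FormalCdga.{u, w} k) (_ : B.IsConnected) (f : A.Hom B) (x : DG.MCmod V.cover A),
      DG.MCmod.fromCover V B (DG.MCmod.map f (DG.LInfty.StrictHom.id V.cover) x) =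
        DG.MCmod.map f (DG.LInfty.StrictHom.id V) (DG.MCmod.fromCover V A x)) ∧
    (∀ (U : DG.LInfty.{u, v} k) (f : V.Hom U) (x : DG.MCmod V.cover A) (y : DG.MCmod U.cover A),
      f.cover.ModMapsTo x y ↔
        f.ModMapsTo (DG.MCmod.fromCover V A x) (DG.MCmod.fromCover U A y)) :=
  ⟨DG.MCmod.fromCover_bijective hA, fun _ _ f x => DG.MCmod.fromCover_map f x,
    fun _ f x y => f.cover_modMapsTo hA x y⟩
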